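/- Let $\Gamma$ be a compact metric graph, that is, a graph with finitely many vertices $V$ and a finite non-empty set $E$ of edges, in which each edge $e$ is identified with an interval $[0,\ell_e]$, $0<\ell_e<\infty$ (loops and multiple edges are allowed). A function on $\Gamma$ is a family $f=(f_e)_{e\in E}$ of functions on the edges; it is continuous on $\Gamma$ if each $f_e$ is continuous on $[0,\ell_e]$ and the values at the edge ends that meet at a vertex agree. Let $L^2(\Gamma)=\bigoplus_{e\in E}L^2(0,\ell_e)$ and $\|f\|_{L^\infty(\Gamma)}=\operatorname{ess\,sup}_\Gamma|f|$. Let $H^1(\Gamma)$ and $\widetilde H^2_C(\Gamma)$ be the spaces of continuous functions on $\Gamma$ that are, on each edge, in $H^1(0,\ell_e)$ and in $H^2(0,\ell_e)$, respectively, and let $H^{3/2}(\Gamma)=(H^1(\Gamma),\widetilde H^2_C(\Gamma))_{1/2}$ be the real interpolation space (K-method, $\int_0^\infty t^{-2}K(t,f)^2\,dt<\infty$). Fix a constant $\kappa>0$. For $u\in H^{3/2}(\Gamma)$ let $\mathcal L_u=\kappa^2-\nabla\cdot(e^u\nabla)$ be the operator on $L^2(\Gamma)$ with standard Kirchhoff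 vertex conditions: its domain consists of the $p\in H^1(\Gamma)$ such that $e^{u_e}p_e'\in H^1(0,\ell_e)$ for every edge $e$ and $$\sum_{e\in E_v}e^{u_e(v)}\,\partial_e p(v)=0\qquad\text{for every } v\in V,$$ where $E_v$ is the set of edges incident to $v$ (a loop counts with both of its ends) and $\partial_e p(v)$ is the derivative at $v$ along $e$, directed from $v$ into the edge; and $(\mathcal L_u p)_e=\kappa^2p_e-(e^{u_e}p_e')'$. Then there are constants $C_1,C_2>0$, depending only on $\Gamma$ and $\kappa$ and not on $u$, such that for every $u\in H^{3/2}(\Gamma)$ the eigenvalues of $\mathcal L_u$, repeated according to their (finite) multiplicities, can be arranged in a non-decreasing sequence $\lambda_1\le\lambda_2\le\cdots$, and $$C_1\,e^{-\|u\|_{L^\infty(\Gamma)}}\,j^2\;\le\;\lambda_j\;\le\;C_2\,e^{\|u\|_{L^\infty(\Gamma)}}\,j^2\qquad\text{for all } j=1,2,3,\dots$$ -/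

import Mathlib

open MeasureTheory

/-- A metric graph with vertex set `V` and edge set `E`: each edge `e` is oriented from `src e` to
`tgt e` and identified with the interval `[0, len e]`. Loops and multiple edges are allowed. The
graph is compact when `V` and `E` are finite. -/
structure MetricGraph (V E : Type*) where
  src : E → V
  tgt : E → V
  len : E → ℝ
  len_pos : ∀ e, 0 < len e

namespace MetricGraph

/-! ### Sobolev spaces on an edge `(0, ℓ)` -/

/-- Lebesgue measure on the interval `(0, ℓ)`. -/
noncomputable abbrev intervalMeasure (ℓ : ℝ) : Measure ℝ := volume.restrict (Set.Ioo 0 ℓ)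

/-- `f` and `g` are in `L²(0, ℓ)` and `g` is the weak (distributional) derivative of `f` on
`(0, ℓ)`. -/
structure HasWeakDeriv (ℓ : ℝ) (f g : ℝ → ℝ) : Prop where
  memLp : MemLp f 2 (intervalMeasure ℓ)
  memLp_deriv : MemLp g 2 (intervalMeasure ℓ)
  integral_eq : ∀ φ : ℝ → ℝ, ContDiff ℝ ((⊤ : ℕ∞) : WithTop ℕ∞) φ → HasCompactSupport φ →
    tsupport φ ⊆ Set.Ioo 0 ℓ →
    ∫ t in Set.Ioo 0 ℓ, f t * deriv φ t = - ∫ t in Set.Ioo 0 ℓ, g t * φ t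

/-- `f ∈ H¹(0, ℓ)`. -/
def MemH1Edge (ℓ : ℝ) (f : ℝ → ℝ) : Prop := ∃ g, HasWeakDeriv ℓ f g

open Classical in
/-- The weak derivative of `f ∈ H¹(0, ℓ)` (a representative of it). -/
noncomputable def weakDeriv (ℓ : ℝ) (f : ℝ → ℝ) : ℝ → ℝ :=
  if h : MemH1Edge ℓ f then h.choose else 0

/-- `f ∈ H²(0, ℓ)`. -/
def MemH2Edge (ℓ : ℝ) (f : ℝ → ℝ) : Prop := MemH1Edge ℓ f ∧ MemH1Edge ℓ (weakDeriv ℓ f)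

/-- The square of the `L²(0, ℓ)` norm. -/
noncomputable def l2SqEdge (ℓ : ℝ) (f : ℝ → ℝ) : ENNReal := eLpNorm f 2 (intervalMeasure ℓ) ^ 2

variable {V E : Type*}

/-! ### Function spaces on the graph

A function `f` on the graph is a family `(f e)` of functions on the edges; only the values of `f e`
on `[0, len e]` matter. -/

/-- `f ∈ C(Γ)`: `f` is continuous on each closed edge, and the values at the ends of the edges that
meet at a vertex agree. -/
def IsContinuous (Γ : MetricGraph V E) (f : E → ℝ → ℝ) : Prop :=
  (∀ e, ContinuousOn (f e) (Set.Icc 0 (Γ.len e))) ∧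
    ∃ F : V → ℝ, ∀ e, f e 0 = F (Γ.src e) ∧ f e (Γ.len e) = F (Γ.tgt e)

/-- `f ∈ H¹(Γ)`. -/
def MemH1 (Γ : MetricGraph V E) (f : E → ℝ → ℝ) : Prop :=
  (∀ e, MemH1Edge (Γ.len e) (f e)) ∧ Γ.IsContinuous f

/-- `f` is in the space of continuous functions on the graph that are in `H²` on each edge. -/
def MemH2C (Γ : MetricGraph V E) (f : E → ℝ → ℝ) : Prop :=
  (∀ e, MemH2Edge (Γ.len e) (f e)) ∧ Γ.IsContinuous f

/-- The square of the `H¹(Γ)` norm. -/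
noncomputable def h1Sq [Fintype E] (Γ : MetricGraph V E) (f : E → ℝ → ℝ) : ENNReal :=
  ∑ e, (l2SqEdge (Γ.len e) (f e) + l2SqEdge (Γ.len e) (weakDeriv (Γ.len e) (f e)))

/-- The square of the edgewise `H²` norm. -/
noncomputable def h2Sq [Fintype E] (Γ : MetricGraph V E) (f : E → ℝ → ℝ) : ENNReal :=
  ∑ e, (l2SqEdge (Γ.len e) (f e) + l2SqEdge (Γ.len e) (weakDeriv (Γ.len e) (f e)) +
    l2SqEdge (Γ.len e) (weakDeriv (Γ.len e) (weakDeriv (Γ.len e) (f e))))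

/-- The square of Peetre's K-functional of the pair `(H¹(Γ), H²_C(Γ))`: the infimum of
`‖g‖² + t² ‖h‖²` over all decompositions `f = g + h` on `Γ`. -/
noncomputable def kFunctionalSq [Fintype E] (Γ : MetricGraph V E) (t : ℝ) (f : E → ℝ → ℝ) :
    ENNReal :=
  ⨅ (g : E → ℝ → ℝ) (h : E → ℝ → ℝ) (_ : Γ.MemH1 g) (_ : Γ.MemH2C h)
    (_ : ∀ e, ∀ x ∈ Set.Icc 0 (Γ.len e), f e x = g e x + h e x),
    Γ.h1Sq g + ENNReal.ofReal (t ^ 2) * Γ.h2Sq h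

/-- `f ∈ H^s(Γ) = (H¹(Γ), H²_C(Γ))_{s-1}` for `1 < s < 2`, by real interpolation (K-method):
`∫₀^∞ (t^{-(s-1)} K(t, f))² dt / t < ∞`. -/
def MemH [Fintype E] (Γ : MetricGraph V E) (s : ℝ) (f : E → ℝ → ℝ) : Prop :=
  Γ.MemH1 f ∧
    ∫⁻ t in Set.Ioi (0 : ℝ), ENNReal.ofReal (t ^ (-2 * (s - 1) - 1)) * Γ.kFunctionalSq t f < ⊤

/-- The `L^∞(Γ)` norm, i.e. the essential supremum of `|f|` over `Γ`. -/
noncomputable def linftyNorm (Γ : MetricGraph V E) (f : E → ℝ → ℝ) : ℝ :=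
  (⨆ e, eLpNorm (f e) ⊤ (intervalMeasure (Γ.len e))).toReal

/-- The Hilbert space `L²(Γ)`, the direct sum of the spaces `L²(e)`. -/
abbrev L2 [Fintype E] (Γ : MetricGraph V E) : Type _ :=
  PiLp 2 (fun e => Lp ℝ 2 (intervalMeasure (Γ.len e)))

/-! ### The operator `κ² - ∇ · (e^u ∇)` with Kirchhoff conditions -/

open Classical in
/-- The flux through the vertex `v`: the sum of `q` over the ends at `v` of all edges, directed
from `v` into the edge (a loop at `v` contributes both of its ends). -/
noncomputable def vertexFlux [Fintype E] (Γ : MetricGraph V E) (q : E → ℝ → ℝ) (v : V) : ℝ :=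
  ∑ e, ((if Γ.src e = v then q e 0 else 0) - (if Γ.tgt e = v then q e (Γ.len e) else 0))

/-- `p` is in the domain of `L_u = κ² - ∇ · (e^u ∇)` and `L_u p = f`. Here `P` is the continuous
representative of `p`, `dP` its derivative, `q` the continuous representative of the flux
`e^u p'`, and `dq` the derivative of the flux. -/
def SolvesKirchhoff [Fintype E] (Γ : MetricGraph V E) (κ : ℝ) (u : E → ℝ → ℝ) (p f : Γ.L2) :
    Prop :=
  ∃ P dP q dq : E → ℝ → ℝ,
    Γ.IsContinuous P ∧
    (∀ e, p e =ᵐ[intervalMeasure (Γ.len e)] P e) ∧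
    (∀ e, HasWeakDeriv (Γ.len e) (P e) (dP e)) ∧
    (∀ e, ContinuousOn (q e) (Set.Icc 0 (Γ.len e))) ∧
    (∀ e, q e =ᵐ[intervalMeasure (Γ.len e)] fun t => Real.exp (u e t) * dP e t) ∧
    (∀ e, HasWeakDeriv (Γ.len e) (q e) (dq e)) ∧
    (∀ v, Γ.vertexFlux q v = 0) ∧
    (∀ e, f e =ᵐ[intervalMeasure (Γ.len e)] fun t => κ ^ 2 * P e t - dq e t)

theorem HasWeakDeriv.zero (ℓ : ℝ) : HasWeakDeriv ℓ 0 0 :=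
  ⟨MemLp.zero, MemLp.zero, fun φ _ _ _ => by simp⟩

theorem HasWeakDeriv.integrable_mul {ℓ : ℝ} {f φ : ℝ → ℝ}
    (hf : MemLp f 2 (intervalMeasure ℓ)) (hφ : Continuous φ) (hc : HasCompactSupport φ) :
    Integrable (fun t => f t * φ t) (intervalMeasure ℓ) := by
  have h2 : MemLp φ 2 (intervalMeasure ℓ) := hφ.memLp_of_hasCompactSupport hc
  exact hf.integrable_mul h2

theorem HasWeakDeriv.add {ℓ : ℝ} {f g f' g' : ℝ → ℝ} (h : HasWeakDeriv ℓ f g)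
    (h' : HasWeakDeriv ℓ f' g') : HasWeakDeriv ℓ (f + f') (g + g') := by
  refine ⟨h.memLp.add h'.memLp, h.memLp_deriv.add h'.memLp_deriv, fun φ hφ hc hs => ?_⟩
  have hd : Continuous (deriv φ) := hφ.continuous_deriv (by simp)
  simp only [Pi.add_apply, add_mul]
  rw [integral_add (integrable_mul h.memLp hd hc.deriv) (integrable_mul h'.memLp hd hc.deriv),
    integral_add (integrable_mul h.memLp_deriv hφ.continuous hc)
      (integrable_mul h'.memLp_deriv hφ.continuous hc),
    h.integral_eq φ hφ hc hs, h'.integral_eq φ hφ hc hs]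
  ring

theorem HasWeakDeriv.const_smul {ℓ : ℝ} {f g : ℝ → ℝ} (h : HasWeakDeriv ℓ f g) (c : ℝ) :
    HasWeakDeriv ℓ (c • f) (c • g) := by
  refine ⟨h.memLp.const_smul c, h.memLp_deriv.const_smul c, fun φ hφ hc hs => ?_⟩
  simp only [Pi.smul_apply, smul_eq_mul, mul_assoc, integral_const_mul,
    h.integral_eq φ hφ hc hs, mul_neg]

theorem HasWeakDeriv.ae_eq_zero {ℓ : ℝ} {f g : ℝ → ℝ} (h : HasWeakDeriv ℓ f g)
    (hf : f =ᵐ[intervalMeasure ℓ] 0) : g =ᵐ[intervalMeasure ℓ] 0 := by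
  have hloc : LocallyIntegrableOn g (Set.Ioo 0 ℓ) volume := by
    have : IntegrableOn g (Set.Ioo 0 ℓ) volume := h.memLp_deriv.integrable (by norm_num)
    exact this.locallyIntegrableOn
  have key := isOpen_Ioo.ae_eq_zero_of_integral_contDiff_smul_eq_zero hloc (fun φ hφ hc hs => by
    have h0 : ∫ t in Set.Ioo 0 ℓ, f t * deriv φ t = 0 := by
      rw [integral_congr_ae (g := fun _ => (0 : ℝ))]
      · simp
      · filter_upwards [hf] with t ht
        simp [ht]
    have h1 := h.integral_eq φ hφ hc hs
    rw [h0] at h1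
    have h2 : ∫ t in Set.Ioo 0 ℓ, g t * φ t = ∫ t, φ t • g t := by
      rw [setIntegral_eq_integral_of_forall_compl_eq_zero]
      · simp [mul_comm]
      · intro x hx
        rw [image_eq_zero_of_notMem_tsupport (fun hx' => hx (hs hx')), mul_zero]
    rw [← h2]
    linarith)
  exact (ae_restrict_iff' measurableSet_Ioo).2 key

/-- The graph of the operator `L_u` in `L²(Γ) × L²(Γ)`. -/
def kirchhoffGraph [Fintype E] (Γ : MetricGraph V E) (κ : ℝ) (u : E → ℝ → ℝ) :
    Submodule ℝ (Γ.L2 × Γ.L2) where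
  carrier := {x | Γ.SolvesKirchhoff κ u x.1 x.2}
  zero_mem' := by
    refine ⟨0, 0, 0, 0, ⟨fun e => continuousOn_const, 0, by simp⟩, fun e => ?_,
      fun e => .zero _, fun e => continuousOn_const, fun e => ?_, fun e => .zero _,
      fun v => by simp [vertexFlux], fun e => ?_⟩
    · simpa using Lp.coeFn_zero ℝ 2 (intervalMeasure (Γ.len e))
    · exact Filter.Eventually.of_forall fun t => by simp
    · filter_upwards [Lp.coeFn_zero ℝ 2 (intervalMeasure (Γ.len e))] with t ht
      simpa using ht
  add_mem' := by
    rintro ⟨p, f⟩ ⟨p', f'⟩ ⟨P, dP, q, dq, ⟨hc, F, hF⟩, hp, hP, hqc, hq, hdq, hv, hf⟩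
      ⟨P', dP', q', dq', ⟨hc', F', hF'⟩, hp', hP', hqc', hq', hdq', hv', hf'⟩
    refine ⟨P + P', dP + dP', q + q', dq + dq', ⟨fun e => (hc e).add (hc' e), F + F', fun e => ?_⟩,
      fun e => ?_, fun e => (hP e).add (hP' e), fun e => (hqc e).add (hqc' e), fun e => ?_,
      fun e => (hdq e).add (hdq' e), fun v => ?_, fun e => ?_⟩
    · simp [hF, hF']
    · filter_upwards [hp e, hp' e, Lp.coeFn_add (p e) (p' e)] with t h1 h2 h3
      simp only [Prod.mk_add_mk, PiLp.add_apply, h3, Pi.add_apply, h1, h2]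
    · filter_upwards [hq e, hq' e] with t h1 h2
      simp only [Pi.add_apply, h1, h2]
      ring
    · have := congrArg₂ (· + ·) (hv v) (hv' v)
      simp only [vertexFlux, add_zero, ← Finset.sum_add_distrib] at this ⊢
      refine (Finset.sum_congr rfl fun e _ => ?_).trans this
      simp only [Pi.add_apply]
      split_ifs <;> ring
    · filter_upwards [hf e, hf' e, Lp.coeFn_add (f e) (f' e)] with t h1 h2 h3
      simp only [Prod.mk_add_mk, PiLp.add_apply, h3, Pi.add_apply, h1, h2]
      ring
  smul_mem' := by
    rintro c ⟨p, f⟩ ⟨P, dP, q, dq, ⟨hc, F, hF⟩, hp, hP, hqc, hq, hdq, hv, hf⟩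
    refine ⟨c • P, c • dP, c • q, c • dq, ⟨fun e => (hc e).const_smul c, c • F, fun e => ?_⟩,
      fun e => ?_, fun e => (hP e).const_smul c, fun e => (hqc e).const_smul c, fun e => ?_,
      fun e => (hdq e).const_smul c, fun v => ?_, fun e => ?_⟩
    · simp [hF]
    · filter_upwards [hp e, Lp.coeFn_smul c (p e)] with t h1 h3
      simp only [Prod.smul_mk, PiLp.smul_apply, h3, Pi.smul_apply, h1]
    · filter_upwards [hq e] with t h1
      simp only [Pi.smul_apply, smul_eq_mul, h1]
      ring
    · have := congrArg (c * ·) (hv v)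
      simp only [vertexFlux, mul_zero, Finset.mul_sum] at this ⊢
      refine (Finset.sum_congr rfl fun e _ => ?_).trans this
      simp only [Pi.smul_apply, smul_eq_mul]
      split_ifs <;> ring
    · filter_upwards [hf e, Lp.coeFn_smul c (f e)] with t h1 h3
      simp only [Prod.smul_mk, PiLp.smul_apply, h3, Pi.smul_apply, h1, smul_eq_mul]
      ring

/-- The unbounded operator `L_u = κ² - ∇ · (e^u ∇)` on `L²(Γ)` with Kirchhoff conditions. -/
noncomputable def kirchhoffOperator [Fintype E] (Γ : MetricGraph V E) (κ : ℝ) (u : E → ℝ → ℝ) :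
    Γ.L2 →ₗ.[ℝ] Γ.L2 :=
  (Γ.kirchhoffGraph κ u).toLinearPMap

/-- `L_u` is single valued, so that `kirchhoffGraph` is indeed its graph. -/
theorem kirchhoffOperator_graph [Fintype E] (Γ : MetricGraph V E) (κ : ℝ) (u : E → ℝ → ℝ) :
    (Γ.kirchhoffOperator κ u).graph = Γ.kirchhoffGraph κ u := by
  refine Submodule.toLinearPMap_graph_eq _ ?_
  rintro ⟨p, f⟩ ⟨P, dP, q, dq, -, hp, hP, -, hq, hdq, -, hf⟩ (h0 : p = 0)
  change f = 0
  subst h0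
  ext e : 1
  refine Lp.ext ?_
  have hP0 : P e =ᵐ[intervalMeasure (Γ.len e)] 0 :=
    (hp e).symm.trans (by simpa using Lp.coeFn_zero ℝ 2 (intervalMeasure (Γ.len e)))
  have hdP0 := (hP e).ae_eq_zero hP0
  have hq0 : q e =ᵐ[intervalMeasure (Γ.len e)] 0 := by
    filter_upwards [hq e, hdP0] with t h1 h2
    simp [h1, h2]
  have hdq0 := (hdq e).ae_eq_zero hq0
  filter_upwards [hf e, hP0, hdq0, Lp.coeFn_zero ℝ 2 (intervalMeasure (Γ.len e))] with t h1 h2 h3 h4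
  simp only [PiLp.zero_apply]
  rw [h4, h1, h2, h3]
  simp

end MetricGraph

/-! ### Eigenvalues of an unbounded operator -/

/-- The eigenspace `{x ∈ D(A) : A x = μ x}` of an unbounded operator `A`. -/
def LinearPMap.eigenspace {H : Type*} [AddCommGroup H] [Module ℝ H] (A : H →ₗ.[ℝ] H) (μ : ℝ) :
    Submodule ℝ H :=
  A.graph.comap (LinearMap.id.prod (μ • LinearMap.id))

theorem LinearPMap.mem_eigenspace_iff {H : Type*} [AddCommGroup H] [Module ℝ H]
    (A : H →ₗ.[ℝ] H) (μ : ℝ) (x : H) :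
    x ∈ A.eigenspace μ ↔ ∃ hx : x ∈ A.domain, A ⟨x, hx⟩ = μ • x := by
  simp [LinearPMap.eigenspace, LinearPMap.mem_graph_iff]

/-- `lam 1 ≤ lam 2 ≤ …` are the eigenvalues of `A` in non-decreasing order, each repeated
according to its multiplicity: every real number `μ` occurs in the sequence exactly as often as the
dimension of its eigenspace says (in particular not at all if `μ` is no eigenvalue). -/
structure IsOrderedEigenvalues {H : Type*} [AddCommGroup H] [Module ℝ H] (A : H →ₗ.[ℝ] H)
    (lam : ℕ+ → ℝ) : Prop where
  mono : Monotone lam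
  multiplicity : ∀ μ : ℝ,
    {j | lam j = μ}.encard = Cardinal.toENat (Module.rank ℝ (A.eigenspace μ))

/-! The quadratic form of `L_u` is `κ² ‖P‖² + ∫ e^u P'²` on continuous functions that are `H¹` on
each edge. With this form as squared norm the form domain is a Hilbert space `K`, realised as the
closed subspace of pairs `(κ P, e^{u/2} P')` in `L²(Γ) × L²(Γ)`. If `J : K → L²(Γ)` is the
embedding, then `J† f` is the weak solution of `L_u p = f`, so `L_u` is exactly the inverse of `J
J†` (`mem_kirchhoffOperator_graph_iff`). Kirchhoff's condition is the natural boundary condition of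
the form.

Everything spectral is then about `J`. If `J` is arbitrarily small on subspaces of finite
codimension, it is compact, and the spectral theorem for `J J†` yields an eigenbasis. The two halves
of the min-max principle turn estimates of `J` into eigenvalue bounds. If `‖J k‖² ≤ c ‖k‖²` on the
common kernel of fewer than `j` functionals, then `λ_j ≥ 1/c` (`IsOrderedEigenvalues.one_le_mul`).
If `‖k‖² ≤ R ‖J k‖²` on a `j`-dimensional space on which `J` is injective, then `λ_j ≤ R`
(`IsOrderedEigenvalues.le_of_norm_sq_le`).

For the lower bound each edge is cut into `n` equal pieces. On functions with mean zero on all `|E|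
n` pieces, the Poincaré inequality gives `c = (Λ/n)² e^{‖u‖}`, where `Λ` bounds the edge lengths;
small `j` are covered by `λ_j ≥ κ²`. For the upper bound the trial space is spanned by the first `j`
Dirichlet sines of a single edge, extended by zero. The weight enters only through `e^{-‖u‖} ≤ e^u ≤
e^{‖u‖}`, so the constants do not depend on `u`. -/

/-! ### Spectral theory of an operator with resolvent `J J†` -/

/-- An infinite family of real numbers with finite sublevel sets can be enumerated in
non-decreasing order. -/
theorem exists_pnat_equiv_monotone {ι : Type*} [Infinite ι] (f : ι → ℝ)
    (hf : ∀ R, {i | f i ≤ R}.Finite) : ∃ e : ℕ+ ≃ ι, Monotone (f ∘ e) := by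
  classical
  have hcount : Countable ι := by
    rw [← Set.countable_univ_iff]
    have : (Set.univ : Set ι) = ⋃ n : ℕ, {i | f i ≤ n} := by
      ext i
      simpa using exists_nat_ge (f i)
    rw [this]
    exact Set.countable_iUnion fun n => (hf n).countable
  obtain ⟨g, hg⟩ := exists_injective_nat ι
  -- Ties of `f` are broken by an injection into `ℕ`, which makes the order on `ι` strict.
  let key : ι → ℝ ×ₗ ℕ := fun i => toLex (f i, g i)
  have hkey : Function.Injective key := fun i i' h => hg (congrArg (fun x => (ofLex x).2) h)
  have hle : ∀ i i', key i ≤ key i' → f i ≤ f i' := by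
    intro i i' h
    rcases (Prod.Lex.le_iff).1 h with h | h
    · exact h.le
    · exact h.1.le
  have hfin : ∀ i, {i' | key i' < key i}.Finite := fun i =>
    (hf (f i)).subset fun i' h => hle _ _ (le_of_lt h)
  -- The rank `r` is injective, so its range is an infinite subset of `ℕ`. The increasing
  -- enumeration of that range transports to `ι` without showing that `r` is surjective.
  let r : ι → ℕ := fun i => {i' | key i' < key i}.ncard
  have hr : ∀ i i', key i < key i' → r i < r i' := by
    intro i i' h
    refine Set.ncard_lt_ncard ?_ (hfin i')
    refine ⟨fun x hx => lt_trans hx h, fun hsub => ?_⟩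
    exact lt_irrefl _ (show key i < key i from hsub h)
  have hrinj : Function.Injective r := by
    intro i i' h
    rcases lt_trichotomy (key i) (key i') with h1 | h1 | h1
    · exact absurd h (hr _ _ h1).ne
    · exact hkey h1
    · exact absurd h (hr _ _ h1).ne'
  have hinf : (Set.range r).Infinite := Set.infinite_range_of_injective hrinj
  have : Infinite (Set.range r) := hinf.to_subtype
  let o : ℕ ≃o Set.range r := Nat.Subtype.orderIsoOfNat (Set.range r)
  let e : ℕ+ ≃ ι := (Equiv.pnatEquivNat.trans o.toEquiv).trans (Equiv.ofInjective r hrinj).symm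
  have hre : ∀ j, r (e j) = o (Equiv.pnatEquivNat j) := fun j => by
    have := Equiv.apply_ofInjective_symm hrinj (o (Equiv.pnatEquivNat j))
    exact this
  refine ⟨e, fun j j' h => ?_⟩
  refine hle _ _ (not_lt.1 fun hlt => ?_)
  have h1 := hr _ _ hlt
  rw [hre, hre] at h1
  have h2 : Equiv.pnatEquivNat j ≤ Equiv.pnatEquivNat j' := by
    simpa [Equiv.pnatEquivNat] using PNat.natPred_le_natPred.2 h
  exact absurd (o.monotone h2) (not_le.2 h1)

theorem LinearPMap.mem_eigenspace {H : Type*} [AddCommGroup H] [Module ℝ H] {A : H →ₗ.[ℝ] H}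
    {μ : ℝ} {x : H} : x ∈ A.eigenspace μ ↔ (x, μ • x) ∈ A.graph := by
  simp [LinearPMap.eigenspace]

/-! ### Compactness criterion and the two halves of the min-max principle -/

section Hilbert

variable {H K : Type*} [NormedAddCommGroup H] [InnerProductSpace ℝ H] [CompleteSpace H]
  [NormedAddCommGroup K] [InnerProductSpace ℝ K] [CompleteSpace K]

open scoped InnerProductSpace

/-- An operator that is arbitrarily small on kernels of finitely many functionals is compact. -/
theorem ContinuousLinearMap.isCompactOperator_of_small_on_ker (J : K →L[ℝ] H)
    (h : ∀ ε > 0, ∃ n : ℕ, ∃ ψ : K →L[ℝ] (Fin n → ℝ), ∀ k, ψ k = 0 → ‖J k‖ ≤ ε * ‖k‖) :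
    IsCompactOperator J := by
  have hcl : IsClosed {f : K →L[ℝ] H | IsCompactOperator f} :=
    isClosed_setOfPred_isCompactOperator
  refine (hcl.closure_eq ▸ Metric.mem_closure_iff.2 fun ε hε => ?_ :
    J ∈ {f : K →L[ℝ] H | IsCompactOperator f})
  obtain ⟨n, ψ, hψ⟩ := h (ε / 2) (half_pos hε)
  let U : Submodule ℝ K := LinearMap.ker ψ.toLinearMap
  have hU : IsClosed (U : Set K) := ψ.isClosed_ker
  have : CompleteSpace U := hU.completeSpace_coe
  -- `ψ` is injective on the complement of its kernel `U`. Hence restricting `J` to `Uᗮ` gives a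
  -- finite rank operator, and the error is `J` after the projection onto `U`.
  have : FiniteDimensional ℝ Uᗮ := by
    refine FiniteDimensional.of_injective (ψ.toLinearMap ∘ₗ Uᗮ.subtype) ?_
    rw [← LinearMap.ker_eq_bot, LinearMap.ker_eq_bot']
    intro x hx
    have hxU : (x : K) ∈ U := hx
    have := U.inner_right_of_mem_orthogonal hxU x.2
    exact Subtype.ext (inner_self_eq_zero.1 this)
  refine ⟨(J ∘L Uᗮ.subtypeL) ∘L Uᗮ.orthogonalProjectionOnto,
    (isCompactOperator_of_locallyCompactSpace_rng (J ∘L Uᗮ.subtypeL)).comp_clm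
      Uᗮ.orthogonalProjectionOnto, ?_⟩
  rw [dist_eq_norm]
  refine lt_of_le_of_lt (ContinuousLinearMap.opNorm_le_bound _ (half_pos hε).le fun k => ?_)
    (half_lt_self hε)
  have hk : k - (Uᗮ.orthogonalProjectionOnto k : K) = U.orthogonalProjectionOnto k := by
    rw [sub_eq_iff_eq_add]
    exact (U.starProjection_add_starProjection_orthogonal k).symm
  have h1 : (J - (J ∘L Uᗮ.subtypeL) ∘L Uᗮ.orthogonalProjectionOnto) k =
      J (U.orthogonalProjectionOnto k) := by
    rw [← hk, map_sub]
    rfl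
  rw [h1]
  refine (hψ _ (U.orthogonalProjectionOnto k).2).trans ?_
  gcongr
  exact U.norm_starProjection_apply_le k

/-- If `J` is small on the kernel of `n` functionals, then `J J†` has at most `n` large
eigenvalues. -/
theorem ContinuousLinearMap.card_le_of_small_on_ker (J : K →L[ℝ] H) {ι : Type*} {φ : ι → H}
    (hφ : Orthonormal ℝ φ) {lam : ι → ℝ} (h0 : ∀ i, lam i ≠ 0)
    (hT : ∀ i, J (J.adjoint (φ i)) = (lam i)⁻¹ • φ i) {n : ℕ} (ψ : K →ₗ[ℝ] (Fin n → ℝ)) {c R : ℝ}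
    (hc : 0 ≤ c) (hψ : ∀ k, ψ k = 0 → ‖J k‖ ^ 2 ≤ c * ‖k‖ ^ 2) (hcR : c * R < 1) (s : Finset ι)
    (hs : ∀ i ∈ s, lam i ≤ R) : s.card ≤ n := by
  classical
  by_contra! hn
  -- The factor `lam i` normalises the trial vectors so that `J (κ a) = ∑ a i • φ i`. Then `‖κ a‖² =
  -- ∑ a i² lam i ≤ R ‖J (κ a)‖²`. With more than `n` of them some nonzero `κ a` lies in the kernel
  -- of `ψ`, which contradicts `c R < 1`.
  let κ : (s → ℝ) →ₗ[ℝ] K := Fintype.linearCombination ℝ fun i : s => lam i • J.adjoint (φ i)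
  obtain ⟨a, ha, ha0⟩ : ∃ a, (ψ ∘ₗ κ) a = 0 ∧ a ≠ 0 := by
    exact Submodule.exists_mem_ne_zero_of_ne_bot
      (LinearMap.ker_ne_bot_of_finrank_lt (f := ψ ∘ₗ κ) (by simpa using hn))
  have hκ : κ a = ∑ i, a i • lam i • J.adjoint (φ i) := by
    simp [κ, Fintype.linearCombination_apply]
  have hJ : J (κ a) = ∑ i, a i • φ i := by
    rw [hκ, map_sum]
    refine Finset.sum_congr rfl fun i _ => ?_
    rw [map_smul, map_smul, hT, smul_inv_smul₀ (h0 _)]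
  have hφs : Orthonormal ℝ fun i : s => φ i := hφ.comp _ Subtype.val_injective
  have h1 : ‖J (κ a)‖ ^ 2 = ∑ i, a i ^ 2 := by
    rw [hJ, ← real_inner_self_eq_norm_sq, hφs.inner_sum]
    simp [sq]
  have h2 : ‖κ a‖ ^ 2 = ∑ i, a i ^ 2 * lam i := by
    rw [← real_inner_self_eq_norm_sq]
    nth_rewrite 1 [hκ]
    rw [sum_inner]
    refine Finset.sum_congr rfl fun i _ => ?_
    rw [real_inner_smul_left, real_inner_smul_left, J.adjoint_inner_left, hJ,
      hφs.inner_right_fintype]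
    ring
  have h3 : ‖κ a‖ ^ 2 ≤ R * ∑ i, a i ^ 2 := by
    rw [h2, Finset.mul_sum]
    exact Finset.sum_le_sum fun i _ => by nlinarith [hs i i.2, sq_nonneg (a i)]
  have h4 : 0 < ∑ i, a i ^ 2 := by
    obtain ⟨i, hi⟩ := Function.ne_iff.1 ha0
    exact Finset.sum_pos' (fun i _ => sq_nonneg _) ⟨i, Finset.mem_univ _, sq_pos_of_ne_zero hi⟩
  have h5 := hψ (κ a) ha
  rw [h1] at h5
  nlinarith [mul_le_mul_of_nonneg_left h3 hc]

/-- If `J J†` has a Hilbert basis of eigenvectors with eigenvalues `(lam i)⁻¹` and `J` is bounded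
below by `R` on a `j`-dimensional space, then `lam j ≤ R`. -/
theorem HilbertBasis.le_of_norm_sq_le (J : K →L[ℝ] H) (b : HilbertBasis ℕ+ ℝ H) {lam : ℕ+ → ℝ}
    (hmono : Monotone lam) (h0 : ∀ i, 0 < lam i)
    (hT : ∀ i, J (J.adjoint (b i)) = (lam i)⁻¹ • b i) (j : ℕ+) {R : ℝ}
    (σ : (Fin j → ℝ) →ₗ[ℝ] K) (hσ : ∀ a, J (σ a) = 0 → a = 0)
    (hR : ∀ a, ‖σ a‖ ^ 2 ≤ R * ‖J (σ a)‖ ^ 2) : lam j ≤ R := by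
  by_contra! hlt
  -- These are `j - 1` conditions on a `j`-dimensional space, so some `q = J (σ a)` with `a ≠ 0` is
  -- orthogonal to the first `j - 1` eigenvectors.
  let ev : K →ₗ[ℝ] (Finset.Ico 1 j → ℝ) := LinearMap.pi fun i => (innerₛₗ ℝ (b i)) ∘ₗ J.toLinearMap
  obtain ⟨a, ha, ha0⟩ : ∃ a, (ev ∘ₗ σ) a = 0 ∧ a ≠ 0 := by
    refine Submodule.exists_mem_ne_zero_of_ne_bot
      (LinearMap.ker_ne_bot_of_finrank_lt (f := ev ∘ₗ σ) ?_)
    simp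
  set q := J (σ a) with hq
  have hq0 : ∀ i < j, ⟪b i, q⟫_ℝ = 0 := fun i hi => by
    simpa [ev] using congrFun ha ⟨i, Finset.mem_Ico.2 ⟨one_le, hi⟩⟩
  have hqne : 0 < ‖q‖ ^ 2 := by
    have : q ≠ 0 := fun h => ha0 (hσ a h)
    positivity
  have hs1 := b.hasSum_inner_mul_inner q q
  have hs2 := b.hasSum_inner_mul_inner (J (J.adjoint q)) q
  have hTq : ∀ i, ⟪J (J.adjoint q), b i⟫_ℝ = (lam i)⁻¹ * ⟪q, b i⟫_ℝ := fun i => by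
    rw [← J.adjoint_inner_right, J.adjoint_inner_left, hT, real_inner_smul_right]
  have h1 : ‖J.adjoint q‖ ^ 2 ≤ (lam j)⁻¹ * ‖q‖ ^ 2 := by
    have e1 : ⟪J (J.adjoint q), q⟫_ℝ = ‖J.adjoint q‖ ^ 2 := by
      rw [← J.adjoint_inner_right, real_inner_self_eq_norm_sq]
    rw [← e1, ← real_inner_self_eq_norm_sq q]
    refine hasSum_le (fun i => ?_) hs2 (hs1.mul_left _)
    rw [hTq, real_inner_comm q (b i), mul_assoc]
    rcases lt_or_ge i j with hi | hi
    · simp [real_inner_comm, hq0 i hi]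
    · exact mul_le_mul_of_nonneg_right (inv_anti₀ (h0 j) (hmono hi)) (mul_self_nonneg _)
  have h2 : ‖q‖ ^ 2 ≤ ‖σ a‖ * ‖J.adjoint q‖ := by
    rw [← real_inner_self_eq_norm_sq]
    nth_rewrite 1 [hq]
    rw [← J.adjoint_inner_right]
    exact real_inner_le_norm _ _
  have h3 := hR a
  rw [← hq] at h3
  -- Cauchy-Schwarz for `‖q‖² = ⟪σ a, J† q⟫` combines the two bounds; dividing by `‖q‖⁴` would give
  -- `lam j ≤ R`.
  have h4 : (‖q‖ ^ 2) ^ 2 ≤ R * ‖q‖ ^ 2 * ((lam j)⁻¹ * ‖q‖ ^ 2) := by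
    calc (‖q‖ ^ 2) ^ 2 ≤ (‖σ a‖ * ‖J.adjoint q‖) ^ 2 := by gcongr
      _ = ‖σ a‖ ^ 2 * ‖J.adjoint q‖ ^ 2 := by ring
      _ ≤ _ := mul_le_mul h3 h1 (by positivity) (le_trans (by positivity) h3)
  have h5 : R * (lam j)⁻¹ < 1 := by
    rw [← div_eq_mul_inv, div_lt_one (h0 j)]
    exact hlt
  nlinarith [mul_pos hqne hqne]

theorem ContinuousLinearMap.isSymmetric_comp_adjoint (J : K →L[ℝ] H) :
    (J ∘L J.adjoint).IsSymmetric := fun x y => by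
  change ⟪J (J.adjoint x), y⟫_ℝ = ⟪x, J (J.adjoint y)⟫_ℝ
  rw [← J.adjoint_inner_right, J.adjoint_inner_left]

/-! ### Eigenvalues of an operator whose inverse is `J J†` -/

section Resolvent

variable {A : H →ₗ.[ℝ] H} {J : K →L[ℝ] H}

theorem LinearPMap.mem_eigenspace_of_inverse
    (hA : ∀ p f, (p, f) ∈ A.graph ↔ p = J (J.adjoint f)) {μ : ℝ} {x : H} :
    x ∈ A.eigenspace μ ↔ x = μ • J (J.adjoint x) := by
  rw [LinearPMap.mem_eigenspace, hA, show J (J.adjoint (μ • x)) = μ • J (J.adjoint x) from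
    (J ∘L J.adjoint).map_smul μ x]

/-- The eigenspaces of an operator with inverse `J J†` are those of `J J†`. -/
theorem LinearPMap.eigenspace_eq_of_inverse
    (hA : ∀ p f, (p, f) ∈ A.graph ↔ p = J (J.adjoint f)) (μ : ℝ) :
    A.eigenspace μ = Module.End.eigenspace (J ∘L J.adjoint : H →L[ℝ] H).toLinearMap μ⁻¹ := by
  ext x
  rw [LinearPMap.mem_eigenspace_of_inverse hA, Module.End.mem_eigenspace_iff]
  change _ ↔ J (J.adjoint x) = μ⁻¹ • x
  -- Since `0⁻¹ = 0`, the case `μ = 0` compares the kernel of `A` with that of `J J†`. Both are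
  -- trivial, the latter because `A` is single valued.
  rcases eq_or_ne μ 0 with rfl | hμ
  · simp only [zero_smul, inv_zero]
    constructor
    · rintro rfl
      simp
    · intro h
      have h1 : ((0 : H), x) ∈ A.graph := (hA 0 x).2 h.symm
      simpa using A.graph_fst_eq_zero_snd h1 rfl
  · rw [eq_inv_smul_iff₀ hμ, eq_comm]

theorem LinearPMap.orthogonalFamily_eigenspace_of_inverse
    (hA : ∀ p f, (p, f) ∈ A.graph ↔ p = J (J.adjoint f)) :
    OrthogonalFamily ℝ (fun μ => A.eigenspace μ) fun μ => (A.eigenspace μ).subtypeₗᵢ := by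
  have h := J.isSymmetric_comp_adjoint.orthogonalFamily_eigenspaces.comp inv_injective
  rw [funext (LinearPMap.eigenspace_eq_of_inverse hA)]
  exact h

theorem LinearPMap.orthogonal_iSup_eigenspace_of_inverse (hJ : IsCompactOperator J)
    (hA : ∀ p f, (p, f) ∈ A.graph ↔ p = J (J.adjoint f)) :
    (⨆ μ, A.eigenspace μ)ᗮ = ⊥ := by
  have h := ContinuousLinearMap.orthogonalComplement_iSup_eigenspaces_eq_bot
    (T := J ∘L J.adjoint) (hJ.comp_clm _) J.isSymmetric_comp_adjoint
  simp only [LinearPMap.eigenspace_eq_of_inverse hA]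
  rw [← h]
  congr 1
  -- Inversion permutes `ℝ`, zero included, so both suprema run over the same eigenspaces.
  exact (Equiv.inv ℝ).iSup_comp
    (g := fun μ => Module.End.eigenspace (J ∘L J.adjoint : H →L[ℝ] H).toLinearMap μ)

theorem LinearPMap.finiteDimensional_eigenspace_of_inverse (hJ : IsCompactOperator J)
    (hA : ∀ p f, (p, f) ∈ A.graph ↔ p = J (J.adjoint f)) (μ : ℝ) :
    FiniteDimensional ℝ (A.eigenspace μ) := by
  rcases eq_or_ne μ 0 with rfl | hμ
  · have : A.eigenspace 0 = ⊥ := by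
      rw [eq_bot_iff]
      intro x hx
      rw [LinearPMap.mem_eigenspace_of_inverse hA] at hx
      simpa using hx
    rw [this]
    infer_instance
  · rw [LinearPMap.eigenspace_eq_of_inverse hA]
    exact ContinuousLinearMap.finite_dimensional_eigenspace (T := J ∘L J.adjoint)
      (hJ.comp_clm _) _ (inv_ne_zero hμ)

/-- Pairing `x = μ J J† x` with `x` gives `‖x‖² = μ ‖J† x‖²`. -/
theorem LinearPMap.eigenspace_pos_of_inverse
    (hA : ∀ p f, (p, f) ∈ A.graph ↔ p = J (J.adjoint f)) {μ : ℝ} {x : H}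
    (hx : x ∈ A.eigenspace μ) (hx0 : x ≠ 0) : 0 < μ := by
  rw [LinearPMap.mem_eigenspace_of_inverse hA] at hx
  have h1 : ‖x‖ ^ 2 = μ * ‖J.adjoint x‖ ^ 2 := by
    rw [← real_inner_self_eq_norm_sq, ← real_inner_self_eq_norm_sq]
    nth_rewrite 1 [hx]
    rw [real_inner_smul_left, ← J.adjoint_inner_right]
  have h2 : 0 < ‖x‖ ^ 2 := by positivity
  rw [h1] at h2
  exact pos_of_mul_pos_left h2 (sq_nonneg _)

/-- A family of orthonormal bases of the eigenspaces is a Hilbert basis. -/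
theorem LinearPMap.exists_hilbertBasis_of_inverse (hJ : IsCompactOperator J)
    (hA : ∀ p f, (p, f) ∈ A.graph ↔ p = J (J.adjoint f)) {ι : ℝ → Type*} [∀ μ, Fintype (ι μ)]
    (hι : ∀ μ, Fintype.card (ι μ) = Module.finrank ℝ (A.eigenspace μ)) :
    ∃ b : HilbertBasis (Σ μ, ι μ) ℝ H, ∀ i, b i ∈ A.eigenspace i.1 := by
  have hfd := LinearPMap.finiteDimensional_eigenspace_of_inverse hJ hA
  let β : ∀ μ, OrthonormalBasis (ι μ) ℝ (A.eigenspace μ) := fun μ =>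
    (stdOrthonormalBasis ℝ (A.eigenspace μ)).reindex
      (Fintype.equivOfCardEq (by rw [hι, Fintype.card_fin]))
  have ho : Orthonormal ℝ fun i : Σ μ, ι μ => (β i.1 i.2 : H) :=
    (LinearPMap.orthogonalFamily_eigenspace_of_inverse hA).orthonormal_sigma_orthonormal
      fun μ => (β μ).orthonormal
  refine ⟨HilbertBasis.mkOfOrthogonalEqBot ho ?_, fun i => ?_⟩
  · rw [eq_bot_iff, ← LinearPMap.orthogonal_iSup_eigenspace_of_inverse hJ hA]
    refine Submodule.orthogonal_le (iSup_le fun μ => ?_)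
    have h1 : A.eigenspace μ = (Submodule.span ℝ (Set.range (β μ))).map
        (A.eigenspace μ).subtype := by
      rw [← (β μ).coe_toBasis, (β μ).toBasis.span_eq, Submodule.map_subtype_top]
    rw [h1, Submodule.map_span]
    refine Submodule.span_mono ?_
    rintro _ ⟨_, ⟨i, rfl⟩, rfl⟩
    exact ⟨⟨μ, i⟩, rfl⟩
  · rw [HilbertBasis.coe_mkOfOrthogonalEqBot]
    exact (β i.1 i.2).2

theorem LinearPMap.apply_eq_inv_smul_of_inverse
    (hA : ∀ p f, (p, f) ∈ A.graph ↔ p = J (J.adjoint f)) {μ : ℝ} {x : H}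
    (hx : x ∈ A.eigenspace μ) : J (J.adjoint x) = μ⁻¹ • x := by
  rw [LinearPMap.eigenspace_eq_of_inverse hA, Module.End.mem_eigenspace_iff] at hx
  exact hx

/-- An operator with compact inverse `J J†` on an infinite dimensional space has a complete
non-decreasing sequence of eigenvalues. -/
theorem exists_isOrderedEigenvalues_of_inverse (hH : ¬ FiniteDimensional ℝ H)
    (hJ : ∀ ε > 0, ∃ n : ℕ, ∃ ψ : K →L[ℝ] (Fin n → ℝ), ∀ k, ψ k = 0 → ‖J k‖ ≤ ε * ‖k‖)
    (hA : ∀ p f, (p, f) ∈ A.graph ↔ p = J (J.adjoint f)) :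
    ∃ lam, IsOrderedEigenvalues A lam := by
  have hJc := J.isCompactOperator_of_small_on_ker hJ
  obtain ⟨b, hb⟩ := LinearPMap.exists_hilbertBasis_of_inverse hJc hA
    (ι := fun μ => Fin (Module.finrank ℝ (A.eigenspace μ))) (fun μ => Fintype.card_fin _)
  have hpos : ∀ i : Σ μ, Fin (Module.finrank ℝ (A.eigenspace μ)), 0 < i.1 := fun i =>
    LinearPMap.eigenspace_pos_of_inverse hA (hb i) (b.orthonormal.ne_zero i)
  have hfin : ∀ R : ℝ, {i : Σ μ, Fin (Module.finrank ℝ (A.eigenspace μ)) | i.1 ≤ R}.Finite := by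
    intro R
    by_contra hinf
    -- This `ε` makes `ε² R < 1`, so at most `n` eigenvalues are `≤ R`.
    obtain ⟨n, ψ, hψ⟩ := hJ (|R| + 1)⁻¹ (by positivity)
    obtain ⟨s, hs, hcard⟩ := Set.Infinite.exists_subset_card_eq hinf (n + 1)
    have := J.card_le_of_small_on_ker b.orthonormal (fun i => (hpos i).ne')
      (fun i => LinearPMap.apply_eq_inv_smul_of_inverse hA (hb i)) ψ.toLinearMap
      (c := ((|R| + 1)⁻¹) ^ 2) (R := R) (by positivity)
      (fun k hk => by
        rw [← mul_pow]
        exact pow_le_pow_left₀ (norm_nonneg _) (hψ k hk) 2) ?_ s (fun i hi => hs hi)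
    · omega
    · have h1 : (0 : ℝ) < |R| + 1 := by positivity
      rw [inv_pow, inv_mul_lt_one₀ (by positivity)]
      nlinarith [le_abs_self R, abs_nonneg R]
  have hinf : Infinite (Σ μ, Fin (Module.finrank ℝ (A.eigenspace μ))) := by
    by_contra hf
    rw [not_infinite_iff_finite] at hf
    have := Fintype.ofFinite (Σ μ, Fin (Module.finrank ℝ (A.eigenspace μ)))
    exact hH (Module.Finite.of_basis b.toOrthonormalBasis.toBasis)
  obtain ⟨e, he⟩ := exists_pnat_equiv_monotone _ hfin
  refine ⟨fun j => (e j).1, he, fun μ => ?_⟩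
  have hfd := LinearPMap.finiteDimensional_eigenspace_of_inverse hJc hA μ
  have h1 : {j | (e j).1 = μ} = e ⁻¹' {i | i.1 = μ} := rfl
  have h2 : {i : Σ μ, Fin (Module.finrank ℝ (A.eigenspace μ)) | i.1 = μ} =
      Set.range (Sigma.mk μ) := by
    ext ⟨ν, i⟩
    constructor
    · rintro rfl
      exact ⟨i, rfl⟩
    · rintro ⟨i, hi⟩
      exact (congrArg Sigma.fst hi).symm
  rw [h1, Set.encard_preimage_of_bijective e.bijective, h2, ← Set.image_univ,
    sigma_mk_injective.encard_image, Set.encard_univ, ENat.card_eq_coe_fintype_card,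
    Fintype.card_fin, ← Module.finrank_eq_rank]
  simp

/-- The bounds concern every admissible enumeration, so the basis must be indexed by the given
`lam`. The fibre of `lam` over `μ` has as many elements as the eigenspace has dimensions and can
index an orthonormal basis of it; the fibres together make up `ℕ+`. -/
theorem IsOrderedEigenvalues.exists_hilbertBasis {lam : ℕ+ → ℝ} (h : IsOrderedEigenvalues A lam)
    (hJ : IsCompactOperator J) (hA : ∀ p f, (p, f) ∈ A.graph ↔ p = J (J.adjoint f)) :
    ∃ b : HilbertBasis ℕ+ ℝ H, ∀ j, b j ∈ A.eigenspace (lam j) := by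
  have hfd := LinearPMap.finiteDimensional_eigenspace_of_inverse hJ hA
  have hm : ∀ μ, {j | lam j = μ}.encard = Module.finrank ℝ (A.eigenspace μ) := fun μ => by
    rw [h.multiplicity, ← Module.finrank_eq_rank]
    simp
  have hfin : ∀ μ, {j | lam j = μ}.Finite := fun μ => by
    rw [← Set.encard_ne_top_iff, hm]
    exact ENat.natCast_ne_top _
  let _ : ∀ μ, Fintype {j // lam j = μ} := fun μ => (hfin μ).fintype
  obtain ⟨b, hb⟩ := LinearPMap.exists_hilbertBasis_of_inverse hJ hA
    (ι := fun μ => {j // lam j = μ}) (fun μ => by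
      rw [← Nat.card_eq_fintype_card]
      refine (Nat.card_coe_set_eq {j | lam j = μ}).trans ?_
      rw [Set.ncard, hm, ENat.toNat_natCast])
  let e : (Σ μ, {j // lam j = μ}) ≃ ℕ+ := Equiv.sigmaFiberEquiv lam
  refine ⟨HilbertBasis.mkOfOrthogonalEqBot (b.orthonormal.comp e.symm e.symm.injective) ?_,
    fun j => ?_⟩
  · rw [e.symm.surjective.range_comp, ← Submodule.orthogonal_closure, b.dense_span,
      Submodule.top_orthogonal_eq_bot]
  · rw [HilbertBasis.coe_mkOfOrthogonalEqBot]
    exact hb (e.symm j)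

/-- Upper bounds for `‖J‖` on spaces of finite codimension are lower bounds for eigenvalues. -/
theorem IsOrderedEigenvalues.one_le_mul {lam : ℕ+ → ℝ} (h : IsOrderedEigenvalues A lam)
    (hJ : IsCompactOperator J) (hA : ∀ p f, (p, f) ∈ A.graph ↔ p = J (J.adjoint f)) (j : ℕ+)
    {n : ℕ} (hn : n < j) (ψ : K →ₗ[ℝ] (Fin n → ℝ)) {c : ℝ} (hc : 0 ≤ c)
    (hψ : ∀ k, ψ k = 0 → ‖J k‖ ^ 2 ≤ c * ‖k‖ ^ 2) : 1 ≤ c * lam j := by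
  obtain ⟨b, hb⟩ := h.exists_hilbertBasis hJ hA
  by_contra! hlt
  -- With `R = lam j`, the `j` indices in `Finset.Icc 1 j` all have eigenvalue at most `R`, although
  -- at most `n < j` of them may.
  have := J.card_le_of_small_on_ker b.orthonormal
    (fun i => (LinearPMap.eigenspace_pos_of_inverse hA (hb i) (b.orthonormal.ne_zero i)).ne')
    (fun i => LinearPMap.apply_eq_inv_smul_of_inverse hA (hb i)) ψ hc hψ hlt
    (Finset.Icc 1 j) (fun i hi => h.mono (Finset.mem_Icc.1 hi).2)
  simp at this
  omega

/-- Upper bounds for the quadratic form on a `j`-dimensional space are upper bounds for the `j`-th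
eigenvalue. -/
theorem IsOrderedEigenvalues.le_of_norm_sq_le {lam : ℕ+ → ℝ} (h : IsOrderedEigenvalues A lam)
    (hJ : IsCompactOperator J) (hA : ∀ p f, (p, f) ∈ A.graph ↔ p = J (J.adjoint f)) (j : ℕ+)
    {R : ℝ} (σ : (Fin j → ℝ) →ₗ[ℝ] K) (hσ : ∀ a, J (σ a) = 0 → a = 0)
    (hR : ∀ a, ‖σ a‖ ^ 2 ≤ R * ‖J (σ a)‖ ^ 2) : lam j ≤ R := by
  obtain ⟨b, hb⟩ := h.exists_hilbertBasis hJ hA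
  exact b.le_of_norm_sq_le J h.mono
    (fun i => LinearPMap.eigenspace_pos_of_inverse hA (hb i) (b.orthonormal.ne_zero i))
    (fun i => LinearPMap.apply_eq_inv_smul_of_inverse hA (hb i)) j σ hσ hR

end Resolvent

end Hilbert

namespace MetricGraph

/-! ### Primitives of square integrable functions on an edge -/

theorem setIntegral_Ioo_eq {ℓ : ℝ} (hℓ : 0 ≤ ℓ) (f : ℝ → ℝ) :
    ∫ t in Set.Ioo 0 ℓ, f t = ∫ t in (0 : ℝ)..ℓ, f t := by
  rw [intervalIntegral.integral_of_le hℓ, integral_Ioc_eq_integral_Ioo]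

theorem memLp_of_continuousOn {ℓ : ℝ} {f : ℝ → ℝ} (hf : ContinuousOn f (Set.Icc 0 ℓ)) (p : ENNReal) :
    MemLp f p (intervalMeasure ℓ) := by
  obtain ⟨C, hC⟩ := isCompact_Icc.exists_bound_of_continuousOn hf
  refine MemLp.of_bound ((hf.mono Set.Ioo_subset_Icc_self).aestronglyMeasurable measurableSet_Ioo)
    C ?_
  filter_upwards [ae_restrict_mem measurableSet_Ioo] with t ht
  exact hC t (Set.Ioo_subset_Icc_self ht)

/-- `g` is in `L²(0, ℓ)` and `P` is a primitive of `g` on `[0, ℓ]`. -/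
structure IsPrimitive (ℓ : ℝ) (P g : ℝ → ℝ) : Prop where
  memLp : MemLp g 2 (intervalMeasure ℓ)
  eq : ∀ t ∈ Set.Icc 0 ℓ, P t = P 0 + ∫ s in (0 : ℝ)..t, g s

namespace IsPrimitive

variable {ℓ : ℝ} {P g Q r : ℝ → ℝ}

theorem intervalIntegrable (h : IsPrimitive ℓ P g) (hℓ : 0 ≤ ℓ) :
    IntervalIntegrable g volume 0 ℓ := by
  have h : IntegrableOn g (Set.Ioo 0 ℓ) volume := h.memLp.integrable (by norm_num)
  rwa [intervalIntegrable_iff_integrableOn_Ioo_of_le hℓ]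

theorem intervalIntegrable_of_mem (h : IsPrimitive ℓ P g) {a b : ℝ} (ha : a ∈ Set.Icc 0 ℓ)
    (hb : b ∈ Set.Icc 0 ℓ) : IntervalIntegrable g volume a b := by
  have hℓ : 0 ≤ ℓ := ha.1.trans ha.2
  refine (h.intervalIntegrable hℓ).mono_set ?_
  rw [Set.uIcc_of_le hℓ]
  exact Set.uIcc_subset_Icc ha hb

theorem sub_eq (h : IsPrimitive ℓ P g) {a b : ℝ} (ha : a ∈ Set.Icc 0 ℓ)
    (hb : b ∈ Set.Icc 0 ℓ) : P b - P a = ∫ s in a..b, g s := by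
  have h0 : (0 : ℝ) ∈ Set.Icc 0 ℓ := ⟨le_rfl, ha.1.trans ha.2⟩
  rw [h.eq a ha, h.eq b hb, ← intervalIntegral.integral_add_adjacent_intervals
    (h.intervalIntegrable_of_mem h0 ha) (h.intervalIntegrable_of_mem ha hb)]
  ring

/-- `P` is controlled only on `[0, ℓ]`. Replacing it by the integral formula on all of `ℝ` gives
access to the calculus of absolutely continuous functions, in particular integration by parts. -/
theorem exists_absolutelyContinuous (h : IsPrimitive ℓ P g) (hℓ : 0 ≤ ℓ) :
    ∃ Q, AbsolutelyContinuousOnInterval Q 0 ℓ ∧ Set.EqOn P Q (Set.Icc 0 ℓ) ∧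
      ∀ᵐ t, t ∈ Set.uIcc 0 ℓ → deriv Q t = g t := by
  have hi := h.intervalIntegrable hℓ
  refine ⟨fun t => P 0 + ∫ s in (0 : ℝ)..t, g s, ?_, h.eq, ?_⟩
  · have hc : AbsolutelyContinuousOnInterval (fun _ : ℝ => P 0) 0 ℓ :=
      (LipschitzWith.const (P 0)).lipschitzOnWith.absolutelyContinuousOnInterval
    exact hc.add (hi.absolutelyContinuousOnInterval_intervalIntegral (by simp))
  · filter_upwards [hi.ae_hasDerivAt_integral] with t ht hmem
    exact ((ht hmem 0 (by simp)).const_add (P 0)).deriv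

theorem continuousOn (h : IsPrimitive ℓ P g) (hℓ : 0 ≤ ℓ) : ContinuousOn P (Set.Icc 0 ℓ) := by
  obtain ⟨Q, hQ, hPQ, -⟩ := h.exists_absolutelyContinuous hℓ
  have := hQ.continuousOn
  rw [Set.uIcc_of_le hℓ] at this
  exact this.congr hPQ

/-- Integration by parts. -/
theorem integral_mul_add_mul (h : IsPrimitive ℓ P g) (h' : IsPrimitive ℓ Q r) (hℓ : 0 ≤ ℓ) :
    ∫ t in Set.Ioo 0 ℓ, (g t * Q t + P t * r t) = P ℓ * Q ℓ - P 0 * Q 0 := by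
  obtain ⟨P₁, hP, hPP, hPd⟩ := h.exists_absolutelyContinuous hℓ
  obtain ⟨Q₁, hQ, hQQ, hQd⟩ := h'.exists_absolutelyContinuous hℓ
  have h0 : (0 : ℝ) ∈ Set.Icc 0 ℓ := ⟨le_rfl, hℓ⟩
  have h1 : ℓ ∈ Set.Icc 0 ℓ := ⟨hℓ, le_rfl⟩
  rw [setIntegral_Ioo_eq hℓ, hPP h0, hPP h1, hQQ h0, hQQ h1, ← hP.integral_deriv_mul_eq_sub hQ]
  refine intervalIntegral.integral_congr_ae ?_
  filter_upwards [hPd, hQd] with t ht ht' hmem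
  have hm := Set.uIoc_subset_uIcc hmem
  rw [ht hm, ht' hm]
  rw [Set.uIcc_of_le hℓ] at hm
  rw [hPP hm, hQQ hm]

theorem of_hasDerivAt (h : ∀ t, HasDerivAt P (g t) t) (hg : Continuous g) :
    IsPrimitive ℓ P g := by
  refine ⟨memLp_of_continuousOn hg.continuousOn 2, fun t _ => ?_⟩
  rw [intervalIntegral.integral_eq_sub_of_hasDerivAt (fun t _ => h t) (hg.intervalIntegrable _ _)]
  ring

theorem memLp_self (h : IsPrimitive ℓ P g) (hℓ : 0 ≤ ℓ) : MemLp P 2 (intervalMeasure ℓ) :=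
  memLp_of_continuousOn (h.continuousOn hℓ) 2

theorem hasWeakDeriv (h : IsPrimitive ℓ P g) (hℓ : 0 ≤ ℓ) : HasWeakDeriv ℓ P g := by
  refine ⟨h.memLp_self hℓ, h.memLp, fun φ hφ hc hs => ?_⟩
  have hd : Continuous (deriv φ) := hφ.continuous_deriv (by simp)
  have h' : IsPrimitive ℓ φ (deriv φ) :=
    of_hasDerivAt (fun t => (hφ.differentiable (by simp) t).hasDerivAt) hd
  have h0 : φ 0 = 0 := image_eq_zero_of_notMem_tsupport fun h => lt_irrefl _ (hs h).1
  have h1 : φ ℓ = 0 := image_eq_zero_of_notMem_tsupport fun h => lt_irrefl _ (hs h).2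
  have key := h.integral_mul_add_mul h' hℓ
  rw [integral_add (HasWeakDeriv.integrable_mul h.memLp hφ.continuous hc)
    (HasWeakDeriv.integrable_mul (h.memLp_self hℓ) hd hc.deriv), h0, h1] at key
  linarith

end IsPrimitive

/-! ### Du Bois-Reymond lemma: from weak derivatives to primitives -/

/-- A function on `(0, ℓ)` with vanishing weak derivative is constant. -/
theorem ae_eq_const_of_integral_mul_deriv_eq_zero {ℓ : ℝ} (hℓ : 0 < ℓ) {f : ℝ → ℝ}
    (hf : MemLp f 2 (intervalMeasure ℓ))
    (h : ∀ φ : ℝ → ℝ, ContDiff ℝ ((⊤ : ℕ∞) : WithTop ℕ∞) φ → HasCompactSupport φ →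
      tsupport φ ⊆ Set.Ioo 0 ℓ → ∫ t in Set.Ioo 0 ℓ, f t * deriv φ t = 0) :
    ∃ c, f =ᵐ[intervalMeasure ℓ] fun _ => c := by
  let ρ : ContDiffBump (ℓ / 2) := ⟨ℓ / 8, ℓ / 4, by positivity, by linarith⟩
  let ω : ℝ → ℝ := ρ.normed volume
  have hω : ContDiff ℝ ((⊤ : ℕ∞) : WithTop ℕ∞) ω := ρ.contDiff_normed
  have hωc : HasCompactSupport ω := ρ.hasCompactSupport_normed
  have hωs : tsupport ω ⊆ Set.Ioo 0 ℓ := by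
    intro t ht
    have := ρ.tsupport_normed_eq (μ := volume) ▸ ht
    rw [Real.closedBall_eq_Icc] at this
    constructor
    · have := this.1; simp only [ρ] at this; linarith
    · have := this.2; simp only [ρ] at this; linarith
  have hω1 : ∫ t, ω t = 1 := ρ.integral_normed
  have hvanish : ∀ χ : ℝ → ℝ, tsupport χ ⊆ Set.Ioo 0 ℓ → ∀ x ∉ Set.Ioo 0 ℓ, χ x = 0 :=
    fun χ hs x hx => image_eq_zero_of_notMem_tsupport fun h' => hx (hs h')
  -- test functions of mean zero are derivatives of test functions
  have hmean : ∀ χ : ℝ → ℝ, ContDiff ℝ ((⊤ : ℕ∞) : WithTop ℕ∞) χ → HasCompactSupport χ →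
      tsupport χ ⊆ Set.Ioo 0 ℓ → ∫ t, χ t = 0 → ∫ t in Set.Ioo 0 ℓ, f t * χ t = 0 := by
    intro χ hχ hc hs h0
    let Φ : ℝ → ℝ := fun t => ∫ s in (0 : ℝ)..t, χ s
    have hΦd : ∀ t, HasDerivAt Φ (χ t) t := fun t =>
      (hχ.continuous.integral_hasStrictDerivAt 0 t).hasDerivAt
    have hderiv : deriv Φ = χ := funext fun t => (hΦd t).deriv
    have hΦ : ContDiff ℝ ((⊤ : ℕ∞) : WithTop ℕ∞) Φ := by
      rw [contDiff_infty_iff_deriv, hderiv]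
      exact ⟨fun t => (hΦd t).differentiableAt, hχ⟩
    obtain ⟨a, b, ha, hb, hab, hsub⟩ : ∃ a b, 0 < a ∧ b < ℓ ∧ a ≤ b ∧ tsupport χ ⊆ Set.Icc a b := by
      rcases (tsupport χ).eq_empty_or_nonempty with he | hne
      · exact ⟨ℓ / 2, ℓ / 2, by positivity, by linarith, le_rfl, by simp [he]⟩
      · obtain ⟨a, ha⟩ := hc.isCompact.exists_isLeast hne
        obtain ⟨b, hb⟩ := hc.isCompact.exists_isGreatest hne
        exact ⟨a, b, (hs ha.1).1, (hs hb.1).2, ha.2 hb.1, fun x hx => ⟨ha.2 hx, hb.2 hx⟩⟩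
    -- To the left of `a` the integrand of `Φ` vanishes; to the right of `b` the integral is the
    -- full one, which is zero.
    have hsupp : tsupport Φ ⊆ Set.Icc a b := by
      refine closure_minimal ?_ isClosed_Icc
      intro t ht
      by_contra hmem
      refine ht ?_
      rw [Set.mem_Icc, not_and_or, not_le, not_le] at hmem
      have hz : ∀ x ∉ Set.Icc a b, χ x = 0 :=
        fun x hx => image_eq_zero_of_notMem_tsupport fun h' => hx (hsub h')
      rcases hmem with hlt | hlt
      · refine intervalIntegral.integral_zero_ae (Filter.Eventually.of_forall fun x hx => hz x ?_)
        intro hx'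
        rcases Set.mem_uIoc.1 hx with h1 | h1 <;> linarith [h1.1, h1.2, hx'.1]
      · have e1 : Φ t = ∫ s, χ s := by
          refine intervalIntegral.integral_eq_integral_of_support_subset ?_
          intro x hx
          have := hsub (subset_tsupport _ hx)
          exact ⟨ha.trans_le this.1, this.2.trans hlt.le⟩
        rw [e1, h0]
    have hΦc : HasCompactSupport Φ := isCompact_Icc.of_isClosed_subset (isClosed_tsupport _) hsupp
    have := h Φ hΦ hΦc (hsupp.trans fun x hx => ⟨ha.trans_le hx.1, hx.2.trans_lt hb⟩)
    rwa [hderiv] at this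
  let c : ℝ := ∫ t in Set.Ioo 0 ℓ, f t * ω t
  have hfc : MemLp (fun t => f t - c) 2 (intervalMeasure ℓ) := hf.sub (memLp_const c)
  have hloc : LocallyIntegrableOn (fun t => f t - c) (Set.Ioo 0 ℓ) volume := by
    have : IntegrableOn (fun t => f t - c) (Set.Ioo 0 ℓ) volume := hfc.integrable (by norm_num)
    exact this.locallyIntegrableOn
  -- Any test function `ψ` becomes one of mean zero after subtracting `m ω`, with `m` its integral.
  -- Hence `∫ f ψ = m ∫ f ω = c ∫ ψ`, so `f - c` annihilates `ψ`.
  have key := isOpen_Ioo.ae_eq_zero_of_integral_contDiff_smul_eq_zero hloc (fun ψ hψ hc hs => by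
    set m : ℝ := ∫ t, ψ t with hm
    have hi : ∀ χ : ℝ → ℝ, Continuous χ → HasCompactSupport χ → Integrable χ :=
      fun χ hχ hc => hχ.integrable_of_hasCompactSupport hc
    have h1 := hmean (fun t => ψ t - m * ω t) (hψ.sub (contDiff_const.mul hω))
      (hc.sub (hωc.mul_left (f := fun _ => m))) ?_ ?_
    · have h2 : ∫ t, ψ t • (f t - c) = ∫ t in Set.Ioo 0 ℓ, (f t - c) * ψ t := by
        rw [setIntegral_eq_integral_of_forall_compl_eq_zero]
        · simp [mul_comm]
        · intro x hx
          rw [hvanish ψ hs x hx, mul_zero]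
      have h3 : m = ∫ t in Set.Ioo 0 ℓ, ψ t :=
        (setIntegral_eq_integral_of_forall_compl_eq_zero (hvanish ψ hs)).symm
      have e1 : Integrable (fun t => f t * ψ t) (intervalMeasure ℓ) :=
        HasWeakDeriv.integrable_mul hf hψ.continuous hc
      have e2 : Integrable (fun t => f t * ω t) (intervalMeasure ℓ) :=
        HasWeakDeriv.integrable_mul hf hω.continuous hωc
      rw [h2]
      have h4 : ∫ t in Set.Ioo 0 ℓ, (f t - c) * ψ t =
          (∫ t in Set.Ioo 0 ℓ, f t * ψ t) - c * m := by
        rw [h3, ← integral_const_mul, ← integral_sub e1 ((hi ψ hψ.continuous hc).restrict.const_mul c)]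
        simp only [sub_mul]
      have h5 : ∫ t in Set.Ioo 0 ℓ, f t * (ψ t - m * ω t) =
          (∫ t in Set.Ioo 0 ℓ, f t * ψ t) - m * c := by
        rw [← integral_const_mul, ← integral_sub e1 (e2.const_mul m)]
        congr 1
        ext t
        ring
      rw [h5] at h1
      rw [h4]
      linarith
    · refine (tsupport_sub _ _).trans (Set.union_subset hs ?_)
      exact (tsupport_mul_subset_right).trans hωs
    · rw [integral_sub (hi ψ hψ.continuous hc) ((hi ω hω.continuous hωc).const_mul m),
        integral_const_mul, hω1, mul_one, sub_self])
  refine ⟨c, ?_⟩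
  have : ∀ᵐ t ∂(intervalMeasure ℓ), f t - c = 0 := (ae_restrict_iff' measurableSet_Ioo).2 key
  filter_upwards [this] with t ht
  linarith

/-- The continuous representative of an `H¹` function is a primitive of its weak derivative. -/
theorem HasWeakDeriv.isPrimitive {ℓ : ℝ} (hℓ : 0 < ℓ) {P g : ℝ → ℝ} (h : HasWeakDeriv ℓ P g)
    (hP : ContinuousOn P (Set.Icc 0 ℓ)) : IsPrimitive ℓ P g := by
  let G : ℝ → ℝ := fun t => ∫ s in (0 : ℝ)..t, g s
  have hG : IsPrimitive ℓ G g := ⟨h.memLp_deriv, fun t _ => by simp [G]⟩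
  have hGw := hG.hasWeakDeriv hℓ.le
  -- `P - G` has weak derivative zero, so it is constant almost everywhere, and by continuity on all
  -- of `[0, ℓ]`.
  have hd : HasWeakDeriv ℓ (P + (-1 : ℝ) • G) (g + (-1 : ℝ) • g) := h.add (hGw.const_smul (-1))
  obtain ⟨c, hc⟩ := ae_eq_const_of_integral_mul_deriv_eq_zero hℓ hd.memLp (fun φ hφ hφc hs => by
    rw [hd.integral_eq φ hφ hφc hs]
    simp)
  have hcont : ContinuousOn (P + (-1 : ℝ) • G) (Set.Icc 0 ℓ) :=
    hP.add ((hG.continuousOn hℓ.le).const_smul _)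
  have heq : Set.EqOn (P + (-1 : ℝ) • G) (fun _ => c) (Set.Icc 0 ℓ) := by
    refine Measure.eqOn_Icc_of_ae_eq volume hℓ.ne ?_ hcont continuousOn_const
    rwa [← restrict_Ioo_eq_restrict_Icc]
  refine ⟨h.memLp_deriv, fun t ht => ?_⟩
  have h1 := heq ht
  have h2 := heq (show (0 : ℝ) ∈ Set.Icc 0 ℓ from ⟨le_rfl, hℓ.le⟩)
  simp [G] at h1 h2
  linarith

/-! ### Poincaré inequalities on intervals and partitions -/

namespace IsPrimitive

variable {ℓ : ℝ} {P g : ℝ → ℝ}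

theorem intervalIntegrable_sq (h : IsPrimitive ℓ P g) {a b : ℝ} (ha : a ∈ Set.Icc 0 ℓ)
    (hb : b ∈ Set.Icc 0 ℓ) : IntervalIntegrable (fun t => g t ^ 2) volume a b := by
  have hℓ : 0 ≤ ℓ := ha.1.trans ha.2
  have h1 : IntegrableOn (fun t => g t ^ 2) (Set.Ioo 0 ℓ) volume := h.memLp.integrable_sq
  rw [← intervalIntegrable_iff_integrableOn_Ioo_of_le hℓ] at h1
  refine h1.mono_set ?_
  rw [Set.uIcc_of_le hℓ]
  exact Set.uIcc_subset_Icc ha hb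

/-- Cauchy-Schwarz. -/
theorem sq_integral_abs_le (h : IsPrimitive ℓ P g) {a b : ℝ} (ha : a ∈ Set.Icc 0 ℓ)
    (hb : b ∈ Set.Icc 0 ℓ) (hab : a < b) :
    (∫ t in a..b, |g t|) ^ 2 ≤ (b - a) * ∫ t in a..b, g t ^ 2 := by
  have hi := (h.intervalIntegrable_of_mem ha hb).abs
  have hi2 := h.intervalIntegrable_sq ha hb
  set D := ∫ t in a..b, |g t| with hD
  -- `m` is the mean of `|g|`; expanding `∫ (|g| - m)² ≥ 0` is the inequality.
  set m := D / (b - a) with hm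
  have hpos : 0 < b - a := sub_pos.2 hab
  have h0 : 0 ≤ ∫ t in a..b, (|g t| - m) ^ 2 :=
    intervalIntegral.integral_nonneg hab.le fun t _ => sq_nonneg _
  have h1 : ∫ t in a..b, (|g t| - m) ^ 2 = (∫ t in a..b, g t ^ 2) - 2 * m * D + (b - a) * m ^ 2 := by
    have : ∀ t, (|g t| - m) ^ 2 = g t ^ 2 - 2 * m * |g t| + m ^ 2 := fun t => by
      rw [sub_sq, sq_abs]; ring
    simp only [this]
    rw [intervalIntegral.integral_add (hi2.sub (hi.const_mul _)) intervalIntegrable_const,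
      intervalIntegral.integral_sub hi2 (hi.const_mul _), intervalIntegral.integral_const_mul,
      intervalIntegral.integral_const, smul_eq_mul]
  rw [h1] at h0
  have h2 : m * (b - a) = D := by rw [hm]; field_simp
  have h3 : 0 ≤ (b - a) * ((∫ t in a..b, g t ^ 2) - 2 * m * D + (b - a) * m ^ 2) :=
    mul_nonneg hpos.le h0
  have h4 : (b - a) * ((∫ t in a..b, g t ^ 2) - 2 * m * D + (b - a) * m ^ 2) =
      (b - a) * (∫ t in a..b, g t ^ 2) - 2 * (m * (b - a)) * D + (m * (b - a)) ^ 2 := by ring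
  rw [h4, h2] at h3
  nlinarith

theorem abs_sub_le (h : IsPrimitive ℓ P g) {a b s t : ℝ} (ha : a ∈ Set.Icc 0 ℓ)
    (hb : b ∈ Set.Icc 0 ℓ) (hs : s ∈ Set.Icc a b) (ht : t ∈ Set.Icc a b) :
    |P t - P s| ≤ ∫ x in a..b, |g x| := by
  have hsub : Set.Icc a b ⊆ Set.Icc 0 ℓ := Set.Icc_subset_Icc ha.1 hb.2
  rw [h.sub_eq (hsub hs) (hsub ht), ← Real.norm_eq_abs,
    intervalIntegral.integral_of_le (hs.1.trans hs.2)]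
  refine (intervalIntegral.norm_integral_le_integral_norm_uIoc).trans ?_
  refine setIntegral_mono_set ?_ (Filter.Eventually.of_forall fun x => abs_nonneg _)
    (LE.le.eventuallyLE ?_)
  · exact (h.intervalIntegrable_of_mem ha hb).abs.1
  · exact Set.Ioc_subset_Ioc (le_min hs.1 ht.1) (max_le hs.2 ht.2)

/-- The Poincaré inequality. -/
theorem integral_sq_le (h : IsPrimitive ℓ P g) {a b : ℝ} (ha : a ∈ Set.Icc 0 ℓ)
    (hb : b ∈ Set.Icc 0 ℓ) (hab : a < b) (hP : ∫ t in a..b, P t = 0) :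
    ∫ t in a..b, P t ^ 2 ≤ (b - a) ^ 2 * ∫ t in a..b, g t ^ 2 := by
  have hℓ : 0 ≤ ℓ := ha.1.trans ha.2
  have hsub : Set.Icc a b ⊆ Set.Icc 0 ℓ := Set.Icc_subset_Icc ha.1 hb.2
  have hc : ContinuousOn P (Set.uIcc a b) := by
    rw [Set.uIcc_of_le hab.le]
    exact (h.continuousOn hℓ).mono hsub
  have hpos : 0 < b - a := sub_pos.2 hab
  set D := ∫ t in a..b, |g t| with hD
  have hosc : ∀ s ∈ Set.Icc a b, ∀ t ∈ Set.Icc a b, P t - P s ≤ D ∧ P s - P t ≤ D := by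
    intro s hs t ht
    have e1 : |P t - P s| ≤ D := h.abs_sub_le ha hb hs ht
    have := abs_le.1 e1
    exact ⟨this.2, by linarith⟩
  -- Because `P` has mean zero, `(b - a) P t` is the integral of `P t - P s` over `s`, so the
  -- oscillation bound `D` also bounds `|P|`.
  have hbound : ∀ t ∈ Set.Icc a b, P t ^ 2 ≤ D ^ 2 := by
    intro t ht
    have e1 : ∫ s in a..b, (P t - P s) = (b - a) * P t := by
      rw [intervalIntegral.integral_sub intervalIntegrable_const hc.intervalIntegrable, hP]
      simp
    have e2 : (b - a) * P t ≤ (b - a) * D := by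
      rw [← e1, ← smul_eq_mul, ← intervalIntegral.integral_const]
      exact intervalIntegral.integral_mono_on hab.le
        (intervalIntegrable_const.sub hc.intervalIntegrable) intervalIntegrable_const
        fun s hs => (hosc s hs t ht).1
    have e3 : -((b - a) * D) ≤ (b - a) * P t := by
      rw [← e1, ← mul_neg, ← smul_eq_mul, ← intervalIntegral.integral_const]
      exact intervalIntegral.integral_mono_on hab.le intervalIntegrable_const
        (intervalIntegrable_const.sub hc.intervalIntegrable)
        fun s hs => by linarith [(hosc s hs t ht).2]
    have e4 : P t ≤ D := le_of_mul_le_mul_left e2 hpos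
    have e5 : -D ≤ P t := le_of_mul_le_mul_left (by linarith) hpos
    exact sq_le_sq' e5 e4
  calc ∫ t in a..b, P t ^ 2 ≤ ∫ t in a..b, D ^ 2 :=
        intervalIntegral.integral_mono_on hab.le (hc.pow 2).intervalIntegrable
          intervalIntegrable_const hbound
    _ = (b - a) * D ^ 2 := by simp
    _ ≤ (b - a) * ((b - a) * ∫ t in a..b, g t ^ 2) :=
        mul_le_mul_of_nonneg_left (h.sq_integral_abs_le ha hb hab) hpos.le
    _ = _ := by ring

/-- The Poincaré inequality for functions with mean zero on `n` subintervals. -/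
theorem integral_sq_le_of_partition (h : IsPrimitive ℓ P g) (hℓ : 0 < ℓ) {n : ℕ} (hn : 0 < n)
    (hP : ∀ i < n, ∫ t in (i * (ℓ / n))..((i + 1 : ℕ) * (ℓ / n)), P t = 0) :
    ∫ t in (0 : ℝ)..ℓ, P t ^ 2 ≤ (ℓ / n) ^ 2 * ∫ t in (0 : ℝ)..ℓ, g t ^ 2 := by
  have hn' : (0 : ℝ) < n := by exact_mod_cast hn
  have hstep : 0 < ℓ / n := by positivity
  have hmem : ∀ i : ℕ, i ≤ n → (i * (ℓ / n) : ℝ) ∈ Set.Icc 0 ℓ := fun i hi => by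
    refine ⟨by positivity, ?_⟩
    have : (i : ℝ) ≤ n := by exact_mod_cast hi
    calc (i * (ℓ / n) : ℝ) ≤ n * (ℓ / n) := by gcongr
      _ = ℓ := by field_simp
  have hend : (n * (ℓ / n) : ℝ) = ℓ := by field_simp
  have hsum : ∀ f : ℝ → ℝ, (∀ a ∈ Set.Icc 0 ℓ, ∀ b ∈ Set.Icc 0 ℓ, IntervalIntegrable f volume a b) →
      ∑ i ∈ Finset.range n, ∫ t in (i * (ℓ / n))..((i + 1 : ℕ) * (ℓ / n)), f t =
        ∫ t in (0 : ℝ)..ℓ, f t := fun f hf => by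
    have := intervalIntegral.sum_integral_adjacent_intervals (μ := volume) (f := f)
      (a := fun i : ℕ => (i * (ℓ / n) : ℝ)) (n := n)
      (fun k hk => hf _ (hmem k hk.le) _ (hmem (k + 1) hk))
    rw [this]
    simp [hend]
  rw [← hsum _ (fun a ha b hb => h.intervalIntegrable_sq ha hb), ← hsum (fun t => P t ^ 2),
    Finset.mul_sum]
  · refine Finset.sum_le_sum fun i hi => ?_
    have hi' := Finset.mem_range.1 hi
    have hlt : (i * (ℓ / n) : ℝ) < (i + 1 : ℕ) * (ℓ / n) := by
      push_cast
      nlinarith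
    have := h.integral_sq_le (hmem i hi'.le) (hmem (i + 1) hi') hlt (hP i hi')
    have e : ((i + 1 : ℕ) * (ℓ / n) - i * (ℓ / n) : ℝ) = ℓ / n := by push_cast; ring
    rwa [e] at this
  · intro a ha b hb
    refine ContinuousOn.intervalIntegrable (((h.continuousOn hℓ.le).pow 2).mono ?_)
    exact Set.uIcc_subset_Icc ha hb

end IsPrimitive

end MetricGraph

namespace MetricGraph

open scoped InnerProductSpace

/-! ### Operators on `L²(0, ℓ)` -/

section Edge

variable {ℓ : ℝ}

theorem inner_eq_of_ae {f g : Lp ℝ 2 (intervalMeasure ℓ)} {f' g' : ℝ → ℝ}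
    (hf : f =ᵐ[intervalMeasure ℓ] f') (hg : g =ᵐ[intervalMeasure ℓ] g') :
    ⟪f, g⟫_ℝ = ∫ t in Set.Ioo 0 ℓ, f' t * g' t := by
  rw [L2.inner_def]
  refine integral_congr_ae ?_
  filter_upwards [hf, hg] with t h1 h2
  rw [h1, h2]
  simp [mul_comm]

/-- Multiplication by `e^{-u/2}` on `L²(0, ℓ)`. -/
noncomputable def weightL {u : ℝ → ℝ} (hu : ContinuousOn u (Set.Icc 0 ℓ)) :
    Lp ℝ 2 (intervalMeasure ℓ) →L[ℝ] Lp ℝ 2 (intervalMeasure ℓ) :=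
  (ContinuousLinearMap.mul ℝ ℝ).holderL (intervalMeasure ℓ) ⊤ 2 2
    ((memLp_of_continuousOn (f := fun t => Real.exp (-u t / 2))
      (hu.neg.div_const 2).rexp ⊤).toLp _)

theorem coeFn_weightL {u : ℝ → ℝ} (hu : ContinuousOn u (Set.Icc 0 ℓ))
    (y : Lp ℝ 2 (intervalMeasure ℓ)) :
    weightL hu y =ᵐ[intervalMeasure ℓ] fun t => Real.exp (-u t / 2) * y t := by
  have h1 := (ContinuousLinearMap.mul ℝ ℝ).coeFn_holder (r := 2)
    ((memLp_of_continuousOn (f := fun t => Real.exp (-u t / 2))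
      (hu.neg.div_const 2).rexp ⊤).toLp _) y
  filter_upwards [h1, MemLp.coeFn_toLp (memLp_of_continuousOn (f := fun t => Real.exp (-u t / 2))
      (hu.neg.div_const 2).rexp ⊤)] with t h2 h3
  rw [weightL, ContinuousLinearMap.holderL_apply_apply, h2, h3]
  rfl

theorem isPrimitive_integral (y : Lp ℝ 2 (intervalMeasure ℓ)) (c : ℝ) :
    IsPrimitive ℓ (fun t => c + ∫ s in (0 : ℝ)..t, y s) y :=
  ⟨Lp.memLp y, fun t _ => by simp⟩

theorem integral_congr_of_ae {f g : ℝ → ℝ} (h : f =ᵐ[intervalMeasure ℓ] g) {a b : ℝ}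
    (ha : a ∈ Set.Icc 0 ℓ) (hb : b ∈ Set.Icc 0 ℓ) :
    ∫ s in a..b, f s = ∫ s in a..b, g s := by
  refine intervalIntegral.integral_congr_ae_restrict ?_
  rw [intervalMeasure, restrict_Ioo_eq_restrict_Ioc] at h
  exact ae_restrict_of_ae_restrict_of_subset
    (Set.Ioc_subset_Ioc (le_min ha.1 hb.1) (max_le ha.2 hb.2)) h

theorem memLp_integral (hℓ : 0 ≤ ℓ) (y : Lp ℝ 2 (intervalMeasure ℓ)) :
    MemLp (fun t => ∫ s in (0 : ℝ)..t, y s) 2 (intervalMeasure ℓ) := by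
  simpa using (isPrimitive_integral y 0).memLp_self hℓ

/-- The operator `y ↦ ∫₀ᵗ y` on `L²(0, ℓ)`. -/
noncomputable def volterraL (hℓ : 0 < ℓ) :
    Lp ℝ 2 (intervalMeasure ℓ) →L[ℝ] Lp ℝ 2 (intervalMeasure ℓ) :=
  LinearMap.mkContinuous
    { toFun := fun y => (memLp_integral hℓ.le y).toLp _
      map_add' := fun y z => by
        rw [← MemLp.toLp_add]
        refine MemLp.toLp_congr _ _ ?_
        filter_upwards [ae_restrict_mem measurableSet_Ioo] with t ht
        have h0 : (0 : ℝ) ∈ Set.Icc 0 ℓ := ⟨le_rfl, hℓ.le⟩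
        have ht' := Set.Ioo_subset_Icc_self ht
        rw [integral_congr_of_ae (Lp.coeFn_add y z) h0 ht']
        exact intervalIntegral.integral_add
          ((isPrimitive_integral y 0).intervalIntegrable_of_mem h0 ht')
          ((isPrimitive_integral z 0).intervalIntegrable_of_mem h0 ht')
      map_smul' := fun c y => by
        rw [RingHom.id_apply, ← MemLp.toLp_const_smul]
        refine MemLp.toLp_congr _ _ ?_
        filter_upwards [ae_restrict_mem measurableSet_Ioo] with t ht
        have h0 : (0 : ℝ) ∈ Set.Icc 0 ℓ := ⟨le_rfl, hℓ.le⟩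
        rw [integral_congr_of_ae (Lp.coeFn_smul c y) h0 (Set.Ioo_subset_Icc_self ht)]
        exact intervalIntegral.integral_smul c _ } ℓ fun y => by
    have hp := isPrimitive_integral y 0
    have h0 : (0 : ℝ) ∈ Set.Icc 0 ℓ := ⟨le_rfl, hℓ.le⟩
    have h1 : ℓ ∈ Set.Icc 0 ℓ := ⟨hℓ.le, le_rfl⟩
    refine le_of_sq_le_sq ?_ (by positivity)
    have hy : ‖y‖ ^ 2 = ∫ t in (0 : ℝ)..ℓ, y t ^ 2 := by
      rw [← real_inner_self_eq_norm_sq, inner_eq_of_ae (ae_eq_refl _) (ae_eq_refl _),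
        setIntegral_Ioo_eq hℓ.le]
      simp only [sq]
    have hF := MemLp.coeFn_toLp (memLp_integral hℓ.le y)
    change ‖(memLp_integral hℓ.le y).toLp _‖ ^ 2 ≤ _
    rw [← real_inner_self_eq_norm_sq, inner_eq_of_ae hF hF, setIntegral_Ioo_eq hℓ.le, mul_pow, hy]
    have hc : ContinuousOn (fun t => ∫ s in (0 : ℝ)..t, y s) (Set.uIcc 0 ℓ) := by
      rw [Set.uIcc_of_le hℓ.le]
      simpa using hp.continuousOn hℓ.le
    -- Cauchy-Schwarz costs one factor `ℓ` pointwise; integrating over `(0, ℓ)` costs the second.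
    have hb : ∀ t ∈ Set.Icc 0 ℓ, (∫ s in (0 : ℝ)..t, y s) * ∫ s in (0 : ℝ)..t, y s ≤
        ℓ * ∫ t in (0 : ℝ)..ℓ, y t ^ 2 := fun t ht => by
      have e1 := hp.abs_sub_le h0 h1 h0 ht
      have e2 := hp.sq_integral_abs_le h0 h1 hℓ
      simp only [zero_add, intervalIntegral.integral_same, sub_zero] at e1 e2
      rw [← sq, ← sq_abs]
      exact (pow_le_pow_left₀ (abs_nonneg _) e1 2).trans e2
    calc _ ≤ ∫ t in (0 : ℝ)..ℓ, (ℓ * ∫ t in (0 : ℝ)..ℓ, y t ^ 2) :=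
          intervalIntegral.integral_mono_on hℓ.le (hc.mul hc).intervalIntegrable
            intervalIntegrable_const hb
      _ = _ := by
        rw [intervalIntegral.integral_const, smul_eq_mul]
        ring

theorem coeFn_volterraL (hℓ : 0 < ℓ) (y : Lp ℝ 2 (intervalMeasure ℓ)) :
    volterraL hℓ y =ᵐ[intervalMeasure ℓ] fun t => ∫ s in (0 : ℝ)..t, y s :=
  MemLp.coeFn_toLp (memLp_integral hℓ.le y)

/-- The functional `y ↦ ∫ₐᵇ y` on `L²(0, ℓ)`. -/
noncomputable def integralL (ℓ a b : ℝ) : Lp ℝ 2 (intervalMeasure ℓ) →L[ℝ] ℝ :=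
  innerSL ℝ (indicatorConstLp 2 (measurableSet_Ioc (a := a) (b := b)) (measure_ne_top _ _) (1 : ℝ))

theorem integralL_eq {a b : ℝ} (ha : a ∈ Set.Icc 0 ℓ) (hb : b ∈ Set.Icc 0 ℓ) (hab : a ≤ b)
    (y : Lp ℝ 2 (intervalMeasure ℓ)) : integralL ℓ a b y = ∫ t in a..b, y t := by
  have h : ((volume : Measure ℝ).restrict (Set.Ioo 0 ℓ)).restrict (Set.Ioc a b) =
      volume.restrict (Set.Ioc a b) := by
    rw [restrict_Ioo_eq_restrict_Ioc, Measure.restrict_restrict measurableSet_Ioc,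
      Set.inter_eq_left.2 (Set.Ioc_subset_Ioc ha.1 hb.2)]
  rw [integralL, innerSL_apply_apply, L2.inner_indicatorConstLp_one,
    intervalIntegral.integral_of_le hab]
  exact congrArg (fun μ => ∫ t, y t ∂μ) h

end Edge

/-! ### The form space -/

section Form

variable {V E : Type*} [Fintype E] (Γ : MetricGraph V E) (κ : ℝ) {u : E → ℝ → ℝ}
  (hu : ∀ e, ContinuousOn (u e) (Set.Icc 0 (Γ.len e)))

/-- The vertex values as a subspace of the target of `constraintL`. -/
noncomputable def vertexData :
    (V → ℝ) →ₗ[ℝ] (∀ e, Lp ℝ 2 (intervalMeasure (Γ.len e))) × (E → ℝ) where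
  toFun F := (fun e => (κ * F (Γ.src e)) • (memLp_const 1).toLp (fun _ => (1 : ℝ)),
    fun e => F (Γ.tgt e) - F (Γ.src e))
  map_add' F G := by
    ext e : 2
    · simp [mul_add, add_smul]
    · simp only [Pi.add_apply, Prod.mk_add_mk]
      ring
  map_smul' c F := by
    ext e : 2
    · simp only [Pi.smul_apply, smul_eq_mul, RingHom.id_apply, Prod.smul_mk, smul_smul]
      congr 1
      ring
    · simp only [Pi.smul_apply, smul_eq_mul, RingHom.id_apply, Prod.smul_mk]
      ring

/-- The defect of `(x, y)` from being of the form `(κ P, e^{u/2} P')`. -/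
noncomputable def constraintL : WithLp 2 (Γ.L2 × Γ.L2) →L[ℝ]
    (∀ e, Lp ℝ 2 (intervalMeasure (Γ.len e))) × (E → ℝ) :=
  (ContinuousLinearMap.pi fun e =>
    PiLp.proj 2 (fun e => Lp ℝ 2 (intervalMeasure (Γ.len e))) e ∘L WithLp.fstL 2 ℝ Γ.L2 Γ.L2 -
      κ • (volterraL (Γ.len_pos e) ∘L weightL (hu e) ∘L
        PiLp.proj 2 (fun e => Lp ℝ 2 (intervalMeasure (Γ.len e))) e ∘L
          WithLp.sndL 2 ℝ Γ.L2 Γ.L2)).prod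
  (ContinuousLinearMap.pi fun e => integralL (Γ.len e) 0 (Γ.len e) ∘L weightL (hu e) ∘L
    PiLp.proj 2 (fun e => Lp ℝ 2 (intervalMeasure (Γ.len e))) e ∘L WithLp.sndL 2 ℝ Γ.L2 Γ.L2)

/-- The form domain of `L_u`, isometrically embedded by `P ↦ (κ P, e^{u/2} P')`. -/
noncomputable def formSpace : Submodule ℝ (WithLp 2 (Γ.L2 × Γ.L2)) :=
  (LinearMap.range (Γ.vertexData κ)).comap (Γ.constraintL κ hu).toLinearMap

/-- The space of vertex data is finite-dimensional, hence closed, and the form space is its preimage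
under a continuous map. This provides the completeness needed for the adjoint of the embedding. -/
theorem isClosed_formSpace [Finite V] :
    IsClosed (Γ.formSpace κ hu : Set (WithLp 2 (Γ.L2 × Γ.L2))) := by
  have : Fintype V := Fintype.ofFinite V
  exact (Submodule.closed_of_finiteDimensional (LinearMap.range (Γ.vertexData κ))).preimage
    (Γ.constraintL κ hu).continuous

instance [Finite V] : CompleteSpace (Γ.formSpace κ hu) :=
  (Γ.isClosed_formSpace κ hu).completeSpace_coe

/-- `k` is the image of `P` with derivative `g` in the form space. -/
structure Represents (u : E → ℝ → ℝ) (k : WithLp 2 (Γ.L2 × Γ.L2)) (P g : E → ℝ → ℝ) : Prop where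
  isContinuous : Γ.IsContinuous P
  isPrimitive : ∀ e, IsPrimitive (Γ.len e) (P e) (g e)
  fst_eq : ∀ e, k.fst e =ᵐ[intervalMeasure (Γ.len e)] fun t => κ * P e t
  snd_eq : ∀ e, k.snd e =ᵐ[intervalMeasure (Γ.len e)] fun t => Real.exp (u e t / 2) * g e t

variable {Γ κ}

/-- Multiplying the second component by `e^{-u/2}` recovers `P'`. The first condition says that `P`
starts at the value `F` of the source and has this derivative, the second that it arrives at the
value of the target. -/
theorem mem_formSpace_iff {k : WithLp 2 (Γ.L2 × Γ.L2)} :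
    k ∈ Γ.formSpace κ hu ↔ ∃ F : V → ℝ, ∀ e,
      (k.fst e =ᵐ[intervalMeasure (Γ.len e)]
        fun t => κ * (F (Γ.src e) + ∫ s in (0 : ℝ)..t, weightL (hu e) (k.snd e) s)) ∧
      F (Γ.tgt e) = F (Γ.src e) + ∫ s in (0 : ℝ)..Γ.len e, weightL (hu e) (k.snd e) s := by
  have hrange : k ∈ Γ.formSpace κ hu ↔ ∃ F, Γ.vertexData κ F = Γ.constraintL κ hu k := Iff.rfl
  have key : ∀ (F : V → ℝ) (e : E),
      ((κ * F (Γ.src e)) • (memLp_const 1).toLp (fun _ => (1 : ℝ)) =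
        k.fst e - κ • volterraL (Γ.len_pos e) (weightL (hu e) (k.snd e)) ↔
      (k.fst e =ᵐ[intervalMeasure (Γ.len e)]
        fun t => κ * (F (Γ.src e) + ∫ s in (0 : ℝ)..t, weightL (hu e) (k.snd e) s))) := by
    intro F e
    set y := weightL (hu e) (k.snd e)
    rw [eq_sub_iff_add_eq, eq_comm, Lp.ext_iff]
    refine Filter.EventuallyEq.congr_right ?_
    have h1 := Lp.coeFn_add ((κ * F (Γ.src e)) •
      (memLp_const (p := 2) (μ := intervalMeasure (Γ.len e)) 1).toLp (fun _ => (1 : ℝ)))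
      (κ • volterraL (Γ.len_pos e) y)
    have h2 := Lp.coeFn_smul (κ * F (Γ.src e))
      ((memLp_const (p := 2) (μ := intervalMeasure (Γ.len e)) 1).toLp (fun _ => (1 : ℝ)))
    have h3 := Lp.coeFn_smul κ (volterraL (Γ.len_pos e) y)
    filter_upwards [h1, h2, h3, coeFn_volterraL (Γ.len_pos e) y,
      (memLp_const (p := 2) (μ := intervalMeasure (Γ.len e)) (1 : ℝ)).coeFn_toLp]
      with t h1 h2 h3 h4 h5
    rw [h1, Pi.add_apply, h2, h3, Pi.smul_apply, Pi.smul_apply, h4, h5, smul_eq_mul, smul_eq_mul]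
    ring
  have h0 : ∀ e, (0 : ℝ) ∈ Set.Icc 0 (Γ.len e) := fun e => ⟨le_rfl, (Γ.len_pos e).le⟩
  have h1 : ∀ e, Γ.len e ∈ Set.Icc 0 (Γ.len e) := fun e => ⟨(Γ.len_pos e).le, le_rfl⟩
  rw [hrange]
  refine exists_congr fun F => ?_
  rw [Prod.ext_iff, funext_iff, funext_iff, ← forall_and]
  refine forall_congr' fun e => and_congr (key F e) ?_
  change F (Γ.tgt e) - F (Γ.src e) =
    integralL (Γ.len e) 0 (Γ.len e) (weightL (hu e) (k.snd e)) ↔ _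
  rw [integralL_eq (h0 e) (h1 e) (Γ.len_pos e).le, sub_eq_iff_eq_add']

theorem exists_represents {k : WithLp 2 (Γ.L2 × Γ.L2)} (hk : k ∈ Γ.formSpace κ hu) :
    ∃ P g, Γ.Represents κ u k P g := by
  obtain ⟨F, hF⟩ := (mem_formSpace_iff hu).1 hk
  have hp := fun e => isPrimitive_integral (weightL (hu e) (k.snd e)) (F (Γ.src e))
  refine ⟨fun e t => F (Γ.src e) + ∫ s in (0 : ℝ)..t, weightL (hu e) (k.snd e) s,
    fun e => weightL (hu e) (k.snd e),
    ⟨fun e => (hp e).continuousOn (Γ.len_pos e).le, F, fun e => ⟨by simp, (hF e).2.symm⟩⟩, hp,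
    fun e => (hF e).1, fun e => ?_⟩
  filter_upwards [coeFn_weightL (hu e) (k.snd e)] with t ht
  rw [ht, ← mul_assoc, ← Real.exp_add]
  ring_nf
  simp

theorem Represents.mem {k : WithLp 2 (Γ.L2 × Γ.L2)} {P g : E → ℝ → ℝ}
    (h : Γ.Represents κ u k P g) : k ∈ Γ.formSpace κ hu := by
  obtain ⟨-, F, hF⟩ := h.isContinuous
  refine (mem_formSpace_iff hu).2 ⟨F, fun e => ?_⟩
  have hw : weightL (hu e) (k.snd e) =ᵐ[intervalMeasure (Γ.len e)] g e := by
    filter_upwards [coeFn_weightL (hu e) (k.snd e), h.snd_eq e] with t h1 h2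
    rw [h1, h2, ← mul_assoc, ← Real.exp_add]
    ring_nf
    simp
  have h0 : (0 : ℝ) ∈ Set.Icc 0 (Γ.len e) := ⟨le_rfl, (Γ.len_pos e).le⟩
  have h1 : Γ.len e ∈ Set.Icc 0 (Γ.len e) := ⟨(Γ.len_pos e).le, le_rfl⟩
  constructor
  · filter_upwards [h.fst_eq e, ae_restrict_mem measurableSet_Ioo] with t h2 ht
    have ht' := Set.Ioo_subset_Icc_self ht
    rw [h2, integral_congr_of_ae hw h0 ht', ← (hF e).1, ← (h.isPrimitive e).eq t ht']
  · rw [integral_congr_of_ae hw h0 h1, ← (hF e).1, ← (hF e).2, (h.isPrimitive e).eq _ h1]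

theorem exists_mem_represents {P g : E → ℝ → ℝ} (hP : Γ.IsContinuous P)
    (hg : ∀ e, IsPrimitive (Γ.len e) (P e) (g e)) :
    ∃ k : Γ.formSpace κ hu, Γ.Represents κ u k P g := by
  have h1 : ∀ e, MemLp (fun t => κ * P e t) 2 (intervalMeasure (Γ.len e)) := fun e =>
    ((hg e).memLp_self (Γ.len_pos e).le).const_mul κ
  have h2 : ∀ e, MemLp (fun t => Real.exp (u e t / 2) * g e t) 2 (intervalMeasure (Γ.len e)) :=
    fun e => (hg e).memLp.mul (memLp_of_continuousOn ((hu e).div_const 2).rexp ⊤)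
  let k : WithLp 2 (Γ.L2 × Γ.L2) := WithLp.toLp 2
    (WithLp.toLp 2 fun e => (h1 e).toLp _, WithLp.toLp 2 fun e => (h2 e).toLp _)
  have hk : Γ.Represents κ u k P g :=
    ⟨hP, hg, fun e => (h1 e).coeFn_toLp, fun e => (h2 e).coeFn_toLp⟩
  exact ⟨⟨k, hk.mem hu⟩, hk⟩

theorem Represents.inner_eq {k k' : WithLp 2 (Γ.L2 × Γ.L2)} {P g P' g' : E → ℝ → ℝ}
    (h : Γ.Represents κ u k P g) (h' : Γ.Represents κ u k' P' g') :
    ⟪k, k'⟫_ℝ = ∑ e, (κ ^ 2 * (∫ t in Set.Ioo 0 (Γ.len e), P e t * P' e t) +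
      ∫ t in Set.Ioo 0 (Γ.len e), Real.exp (u e t) * g e t * g' e t) := by
  rw [WithLp.prod_inner_apply, PiLp.inner_apply, PiLp.inner_apply, ← Finset.sum_add_distrib]
  refine Finset.sum_congr rfl fun e _ => ?_
  congr 1
  · refine (inner_eq_of_ae (h.fst_eq e) (h'.fst_eq e)).trans ?_
    rw [← integral_const_mul]
    congr 1
    ext t
    ring
  · refine (inner_eq_of_ae (h.snd_eq e) (h'.snd_eq e)).trans ?_
    congr 1
    ext t
    rw [show Real.exp (u e t) = Real.exp (u e t / 2) * Real.exp (u e t / 2) by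
      rw [← Real.exp_add]; ring_nf]
    ring

variable (κ) in
/-- The embedding of the form space into `L²(Γ)`. -/
noncomputable def embeddingL : Γ.formSpace κ hu →L[ℝ] Γ.L2 :=
  κ⁻¹ • (WithLp.fstL 2 ℝ Γ.L2 Γ.L2 ∘L (Γ.formSpace κ hu).subtypeL)

theorem Represents.embeddingL_eq (hκ : κ ≠ 0) {k : Γ.formSpace κ hu} {P g : E → ℝ → ℝ}
    (h : Γ.Represents κ u k P g) (e : E) :
    embeddingL κ hu k e =ᵐ[intervalMeasure (Γ.len e)] P e := by
  have h1 : embeddingL κ hu k e = κ⁻¹ • (k : WithLp 2 (Γ.L2 × Γ.L2)).fst e := rfl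
  rw [h1]
  filter_upwards [h.fst_eq e, Lp.coeFn_smul κ⁻¹ ((k : WithLp 2 (Γ.L2 × Γ.L2)).fst e)] with t h2 h3
  rw [h3, Pi.smul_apply, h2, smul_eq_mul, inv_mul_cancel_left₀ hκ]

theorem Represents.inner_embeddingL (hκ : κ ≠ 0) {k : Γ.formSpace κ hu} {P g : E → ℝ → ℝ}
    (h : Γ.Represents κ u k P g) {f : Γ.L2} {f' : E → ℝ → ℝ}
    (hf : ∀ e, f e =ᵐ[intervalMeasure (Γ.len e)] f' e) :
    ⟪f, embeddingL κ hu k⟫_ℝ = ∑ e, ∫ t in Set.Ioo 0 (Γ.len e), f' e t * P e t := by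
  rw [PiLp.inner_apply]
  exact Finset.sum_congr rfl fun e _ => inner_eq_of_ae (hf e) (h.embeddingL_eq hu hκ e)

theorem Represents.norm_sq_embeddingL (hκ : κ ≠ 0) {k : Γ.formSpace κ hu} {P g : E → ℝ → ℝ}
    (h : Γ.Represents κ u k P g) :
    ‖embeddingL κ hu k‖ ^ 2 = ∑ e, ∫ t in Set.Ioo 0 (Γ.len e), P e t ^ 2 := by
  rw [← real_inner_self_eq_norm_sq, h.inner_embeddingL hu hκ (h.embeddingL_eq hu hκ)]
  simp only [sq]

theorem Represents.norm_sq_eq {k : Γ.formSpace κ hu} {P g : E → ℝ → ℝ}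
    (h : Γ.Represents κ u k P g) :
    ‖k‖ ^ 2 = ∑ e, (κ ^ 2 * (∫ t in Set.Ioo 0 (Γ.len e), P e t ^ 2) +
      ∫ t in Set.Ioo 0 (Γ.len e), Real.exp (u e t) * g e t ^ 2) := by
  rw [← real_inner_self_eq_norm_sq, Submodule.coe_inner, h.inner_eq h]
  simp only [sq, mul_assoc]

end Form

end MetricGraph

namespace MetricGraph

open scoped InnerProductSpace

/-! ### The operator `L_u` is the inverse of `J J†` -/

section Single

variable {V E : Type*} {Γ : MetricGraph V E}

theorem isContinuous_single [DecidableEq E] {e : E} {P : ℝ → ℝ}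
    (hP : ContinuousOn P (Set.Icc 0 (Γ.len e))) (h0 : P 0 = 0) (h1 : P (Γ.len e) = 0) :
    Γ.IsContinuous (Pi.single e P) := by
  refine ⟨fun e' => ?_, 0, fun e' => ?_⟩
  · rcases eq_or_ne e' e with rfl | h
    · simpa using hP
    · rw [Pi.single_eq_of_ne h]
      exact continuousOn_const
  · rcases eq_or_ne e' e with rfl | h
    · simp [h0, h1]
    · simp [Pi.single_eq_of_ne h]

theorem isPrimitive_zero (ℓ : ℝ) : IsPrimitive ℓ 0 0 := ⟨MemLp.zero, fun t _ => by simp⟩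

theorem isPrimitive_single [DecidableEq E] {e : E} {P g : ℝ → ℝ}
    (h : IsPrimitive (Γ.len e) P g) (e' : E) :
    IsPrimitive (Γ.len e') ((Pi.single e P : E → ℝ → ℝ) e') ((Pi.single e g : E → ℝ → ℝ) e') := by
  rcases eq_or_ne e' e with rfl | h'
  · simpa using h
  · rw [Pi.single_eq_of_ne h', Pi.single_eq_of_ne h']
    exact isPrimitive_zero _

end Single

section Operator

variable {V E : Type*} [Fintype E] {Γ : MetricGraph V E} {κ : ℝ} {u : E → ℝ → ℝ}

/-- Summation over edge ends is summation over vertices. -/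
theorem sum_boundary [Fintype V] (q : E → ℝ → ℝ) (F : V → ℝ) :
    ∑ e, (q e (Γ.len e) * F (Γ.tgt e) - q e 0 * F (Γ.src e)) =
      -∑ v, F v * Γ.vertexFlux q v := by
  classical
  simp only [vertexFlux, Finset.mul_sum]
  rw [Finset.sum_comm, ← Finset.sum_neg_distrib]
  refine Finset.sum_congr rfl fun e _ => ?_
  simp only [mul_sub, mul_ite, mul_zero, Finset.sum_sub_distrib, Finset.sum_ite_eq,
    Finset.mem_univ, if_true]
  ring

theorem integrable_mul {ℓ : ℝ} {f g : ℝ → ℝ} (hf : MemLp f 2 (intervalMeasure ℓ))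
    (hg : MemLp g 2 (intervalMeasure ℓ)) : IntegrableOn (fun t => f t * g t) (Set.Ioo 0 ℓ) :=
  hf.integrable_mul hg

theorem memLp_exp_mul {ℓ : ℝ} {u g : ℝ → ℝ} (hu : ContinuousOn u (Set.Icc 0 ℓ))
    (hg : MemLp g 2 (intervalMeasure ℓ)) :
    MemLp (fun t => Real.exp (u t) * g t) 2 (intervalMeasure ℓ) :=
  hg.mul (memLp_of_continuousOn hu.rexp ⊤)

/-- The sum of the integrals of `(q P)'` over the edges. -/
theorem sum_integral_mul_add_mul [Fintype V] {P g q r : E → ℝ → ℝ} (hP : Γ.IsContinuous P)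
    (hg : ∀ e, IsPrimitive (Γ.len e) (P e) (g e)) (hq : ∀ e, IsPrimitive (Γ.len e) (q e) (r e)) :
    ∃ F : V → ℝ, (∀ e, P e 0 = F (Γ.src e) ∧ P e (Γ.len e) = F (Γ.tgt e)) ∧
      ∑ e, ∫ t in Set.Ioo 0 (Γ.len e), (r e t * P e t + q e t * g e t) =
        -∑ v, F v * Γ.vertexFlux q v := by
  obtain ⟨-, F, hF⟩ := hP
  refine ⟨F, hF, ?_⟩
  rw [← sum_boundary]
  refine Finset.sum_congr rfl fun e _ => ?_
  rw [(hq e).integral_mul_add_mul (hg e) (Γ.len_pos e).le, (hF e).1, (hF e).2]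

variable [Fintype V] (hu : ∀ e, ContinuousOn (u e) (Set.Icc 0 (Γ.len e)))

variable (κ) in
/-- The adjoint of the embedding of the form space, which maps `f` to the weak solution `p` of
`L_u p = f`. -/
noncomputable abbrev embeddingAdjointL : Γ.L2 →L[ℝ] Γ.formSpace κ hu :=
  ContinuousLinearMap.adjoint (𝕜 := ℝ) (E := Γ.formSpace κ hu) (F := Γ.L2) (embeddingL κ hu)

/-- Testing the equation against any element of the form space and integrating by parts on each edge
leaves the vertex values times the vertex fluxes, which vanish by Kirchhoff's condition. What
remains is `⟪k, k'⟫ = ⟪f, J k'⟫`, that is, `k = J† f`. -/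
theorem SolvesKirchhoff.eq_embeddingL (hκ : κ ≠ 0) {p f : Γ.L2} (h : Γ.SolvesKirchhoff κ u p f) :
    p = embeddingL κ hu (embeddingAdjointL κ hu f) := by
  obtain ⟨P, dP, q, dq, hc, hp, hP, hqc, hq, hdq, hv, hf⟩ := h
  have hPp := fun e => (hP e).isPrimitive (Γ.len_pos e) (hc.1 e)
  have hqp := fun e => (hdq e).isPrimitive (Γ.len_pos e) (hqc e)
  obtain ⟨k, hk⟩ := exists_mem_represents (κ := κ) hu hc hPp
  have hpk : p = embeddingL κ hu k := by
    ext e : 1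
    exact Lp.ext ((hp e).trans (hk.embeddingL_eq hu hκ e).symm)
  have hkf : k = embeddingAdjointL κ hu f := by
    refine ext_inner_right ℝ fun k' => ?_
    obtain ⟨P', g', hk'⟩ := exists_represents hu k'.2
    rw [ContinuousLinearMap.adjoint_inner_left, hk'.inner_embeddingL hu hκ hf,
      Submodule.coe_inner, hk.inner_eq hk']
    obtain ⟨F, -, hF⟩ := sum_integral_mul_add_mul hk'.isContinuous hk'.isPrimitive hqp
    simp only [hv, mul_zero, Finset.sum_const_zero, neg_zero] at hF
    rw [← sub_eq_zero, ← Finset.sum_sub_distrib]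
    refine (Finset.sum_congr rfl fun e _ => ?_).trans hF
    have hℓ := (Γ.len_pos e).le
    have m1 := (hPp e).memLp_self hℓ
    have m2 := (hk'.isPrimitive e).memLp_self hℓ
    have i1 := integrable_mul m1 m2
    have i2 := integrable_mul (hdq e).memLp_deriv m2
    have i3 := integrable_mul (hdq e).memLp (hk'.isPrimitive e).memLp
    have e1 : ∫ t in Set.Ioo 0 (Γ.len e), Real.exp (u e t) * dP e t * g' e t =
        ∫ t in Set.Ioo 0 (Γ.len e), q e t * g' e t := by
      refine integral_congr_ae ?_
      filter_upwards [hq e] with t ht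
      rw [ht]
    have e2 := integral_add i2 i3
    have e3 := integral_sub (i1.const_mul (κ ^ 2)) i2
    rw [integral_const_mul] at e3
    have e4 : ∫ t in Set.Ioo 0 (Γ.len e), (κ ^ 2 * P e t - dq e t) * P' e t =
        ∫ t in Set.Ioo 0 (Γ.len e), (κ ^ 2 * (P e t * P' e t) - dq e t * P' e t) := by
      congr 1
      ext t
      ring
    rw [e1, e2, e4, e3]
    ring
  rw [hpk, ← hkf]

/-- The weak form of `k = J† f`. -/
theorem Represents.sum_integral_adjoint_eq (hκ : κ ≠ 0) {f : Γ.L2} {P g P' g' : E → ℝ → ℝ}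
    (hk : Γ.Represents κ u (embeddingAdjointL κ hu f : Γ.formSpace κ hu) P g)
    (hP' : Γ.IsContinuous P') (hg' : ∀ e, IsPrimitive (Γ.len e) (P' e) (g' e)) :
    ∑ e, ∫ t in Set.Ioo 0 (Γ.len e), ((κ ^ 2 * P e t - f e t) * P' e t +
      Real.exp (u e t) * g e t * g' e t) = 0 := by
  obtain ⟨k', hk'⟩ := exists_mem_represents (κ := κ) hu hP' hg'
  have h1 := hk.inner_eq hk'
  rw [← Submodule.coe_inner, ContinuousLinearMap.adjoint_inner_left,
    hk'.inner_embeddingL hu hκ (f' := fun e => f e) (fun e => ae_eq_refl _), eq_comm,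
    ← sub_eq_zero, ← Finset.sum_sub_distrib] at h1
  refine (Finset.sum_congr rfl fun e _ => ?_).trans h1
  have hℓ := (Γ.len_pos e).le
  have m1 := (hk.isPrimitive e).memLp_self hℓ
  have m2 := (hg' e).memLp_self hℓ
  have i1 := integrable_mul m1 m2
  have i2 := integrable_mul (Lp.memLp (f e)) m2
  have i3 := integrable_mul (memLp_exp_mul (hu e) (hk.isPrimitive e).memLp) (hg' e).memLp
  have e1 := integral_add (i1.const_mul (κ ^ 2)) i3
  have e2 := integral_sub ((i1.const_mul (κ ^ 2)).add i3) i2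
  simp only [Pi.add_apply] at e2
  rw [← integral_const_mul, ← e1, ← e2]
  congr 1
  ext t
  ring

/-- On every edge the flux of `J† f` is a primitive. -/
theorem Represents.exists_flux_eq (hκ : κ ≠ 0) {f : Γ.L2} {P g : E → ℝ → ℝ}
    (hk : Γ.Represents κ u (embeddingAdjointL κ hu f : Γ.formSpace κ hu) P g) (e : E) :
    ∃ c, (fun t => Real.exp (u e t) * g e t) =ᵐ[intervalMeasure (Γ.len e)]
      fun t => c + ∫ s in (0 : ℝ)..t, (κ ^ 2 * P e s - f e s) := by
  classical
  set ℓ := Γ.len e with hℓdef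
  have hpos : 0 < ℓ := Γ.len_pos e
  let r : ℝ → ℝ := fun s => κ ^ 2 * P e s - f e s
  let q : ℝ → ℝ := fun t => ∫ s in (0 : ℝ)..t, r s
  let w : ℝ → ℝ := fun t => Real.exp (u e t) * g e t
  have hr : MemLp r 2 (intervalMeasure ℓ) :=
    (((hk.isPrimitive e).memLp_self hpos.le).const_mul _).sub (Lp.memLp (f e))
  have hq : IsPrimitive ℓ q r := ⟨hr, fun t _ => by simp [q]⟩
  have hw : MemLp w 2 (intervalMeasure ℓ) := memLp_exp_mul (hu e) (hk.isPrimitive e).memLp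
  -- With `c` the mean of `w - q`, the primitive `P'` of `g' = w - q - c` vanishes at both ends and,
  -- extended by zero, is an admissible test function. The weak form minus integration by parts of
  -- `q P'` gives `∫ (w - q) g' = 0`, hence `∫ g'² = 0`.
  let c : ℝ := (∫ t in Set.Ioo 0 ℓ, (w t - q t)) / ℓ
  let g' : ℝ → ℝ := fun t => w t - q t - c
  have hwq : MemLp (fun t => w t - q t) 2 (intervalMeasure ℓ) := hw.sub (hq.memLp_self hpos.le)
  have hg'm : MemLp g' 2 (intervalMeasure ℓ) := hwq.sub (memLp_const c)
  let P' : ℝ → ℝ := fun t => ∫ s in (0 : ℝ)..t, g' s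
  have hP' : IsPrimitive ℓ P' g' := ⟨hg'm, fun t _ => by simp [P']⟩
  have h0 : P' 0 = 0 := by simp [P']
  have hmean : ∫ t in Set.Ioo 0 ℓ, g' t = 0 := by
    have i1 : Integrable (fun t => w t - q t) (intervalMeasure ℓ) := hwq.integrable (by norm_num)
    have : ∫ t in Set.Ioo 0 ℓ, g' t = (∫ t in Set.Ioo 0 ℓ, (w t - q t)) - ∫ t in Set.Ioo 0 ℓ, c :=
      integral_sub i1 (integrable_const c)
    rw [this, setIntegral_const, Measure.real, Real.volume_Ioo, sub_zero,
      ENNReal.toReal_ofReal hpos.le, smul_eq_mul, mul_div_cancel₀ _ hpos.ne', sub_self]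
  have h1 : P' ℓ = 0 := by
    rw [← hmean, setIntegral_Ioo_eq hpos.le]
  have hweak := hk.sum_integral_adjoint_eq hu hκ
    (isContinuous_single (hP'.continuousOn hpos.le) h0 h1) (isPrimitive_single hP')
  rw [Finset.sum_eq_single e (fun e' _ h => by simp [Pi.single_eq_of_ne h]) (by simp)] at hweak
  simp only [Pi.single_eq_same] at hweak
  have hparts := hq.integral_mul_add_mul hP' hpos.le
  rw [h0, h1, mul_zero, mul_zero, sub_zero] at hparts
  have j1 := integrable_mul hr (hP'.memLp_self hpos.le)
  have j2 := integrable_mul hw hg'm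
  have j3 := integrable_mul (hq.memLp_self hpos.le) hg'm
  have hg'i : Integrable g' (intervalMeasure ℓ) := hg'm.integrable (by norm_num)
  have hsq : ∫ t in Set.Ioo 0 ℓ, g' t ^ 2 = 0 := by
    have e1 : ∫ t in Set.Ioo 0 ℓ, g' t ^ 2 =
        (∫ t in Set.Ioo 0 ℓ, (r t * P' t + w t * g' t)) -
          (∫ t in Set.Ioo 0 ℓ, (r t * P' t + q t * g' t)) - c * ∫ t in Set.Ioo 0 ℓ, g' t := by
      have e2 := integral_sub (j1.add j2) (j1.add j3)
      have e3 := integral_sub ((j1.add j2).sub (j1.add j3)) (hg'i.const_mul c)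
      simp only [Pi.add_apply, Pi.sub_apply] at e2 e3
      rw [← integral_const_mul, ← e2, ← e3]
      congr 1
      ext t
      simp only [g']
      ring
    rw [e1, hparts, hmean, mul_zero, sub_zero, sub_zero]
    exact hweak
  refine ⟨c, ?_⟩
  have hz := (integral_eq_zero_iff_of_nonneg (fun t => sq_nonneg (g' t)) hg'm.integrable_sq).1 hsq
  filter_upwards [hz] with t ht
  have : g' t = 0 := by simpa using ht
  have h2 : w t = c + q t := by simp only [g'] at this; linarith
  exact h2

theorem solvesKirchhoff_adjoint (hκ : κ ≠ 0) (f : Γ.L2) :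
    Γ.SolvesKirchhoff κ u (embeddingL κ hu (embeddingAdjointL κ hu f)) f := by
  classical
  obtain ⟨P, g, hk⟩ := exists_represents hu (embeddingAdjointL κ hu f).2
  choose c hc using hk.exists_flux_eq hu hκ
  let r : E → ℝ → ℝ := fun e s => κ ^ 2 * P e s - f e s
  let q : E → ℝ → ℝ := fun e t => c e + ∫ s in (0 : ℝ)..t, r e s
  have hr : ∀ e, MemLp (r e) 2 (intervalMeasure (Γ.len e)) := fun e =>
    (((hk.isPrimitive e).memLp_self (Γ.len_pos e).le).const_mul _).sub (Lp.memLp (f e))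
  have hq : ∀ e, IsPrimitive (Γ.len e) (q e) (r e) := fun e => ⟨hr e, fun t _ => by simp [q]⟩
  have hqg : ∀ e, q e =ᵐ[intervalMeasure (Γ.len e)] fun t => Real.exp (u e t) * g e t :=
    fun e => (hc e).symm
  refine ⟨P, g, q, r, hk.isContinuous, fun e => hk.embeddingL_eq hu hκ e,
    fun e => (hk.isPrimitive e).hasWeakDeriv (Γ.len_pos e).le,
    fun e => (hq e).continuousOn (Γ.len_pos e).le, hqg,
    fun e => (hq e).hasWeakDeriv (Γ.len_pos e).le, fun v => ?_,
    fun e => Filter.Eventually.of_forall fun t => by simp only [r]; ring⟩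
  -- The test function is affine on each edge, one at `v` and zero at all other vertices. Since the
  -- equation already holds on the edges, the weak form isolates the flux at `v`.
  let F₀ : V → ℝ := Pi.single v 1
  let P' : E → ℝ → ℝ := fun e t =>
    F₀ (Γ.src e) + (F₀ (Γ.tgt e) - F₀ (Γ.src e)) / Γ.len e * t
  let g' : E → ℝ → ℝ := fun e _ => (F₀ (Γ.tgt e) - F₀ (Γ.src e)) / Γ.len e
  have hP' : ∀ e, IsPrimitive (Γ.len e) (P' e) (g' e) := fun e =>
    IsPrimitive.of_hasDerivAt (fun t => by
      simpa [P', g'] using ((hasDerivAt_id t).const_mul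
        ((F₀ (Γ.tgt e) - F₀ (Γ.src e)) / Γ.len e)).const_add (F₀ (Γ.src e))) continuous_const
  have hends : ∀ e, P' e 0 = F₀ (Γ.src e) ∧ P' e (Γ.len e) = F₀ (Γ.tgt e) := fun e => by
    refine ⟨by simp [P'], ?_⟩
    simp only [P']
    rw [div_mul_cancel₀ _ (Γ.len_pos e).ne']
    ring
  have hcont : Γ.IsContinuous P' :=
    ⟨fun e => (hP' e).continuousOn (Γ.len_pos e).le, F₀, hends⟩
  have hweak := hk.sum_integral_adjoint_eq hu hκ hcont hP'
  have hparts : ∑ e, ∫ t in Set.Ioo 0 (Γ.len e), (r e t * P' e t + q e t * g' e t) =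
      -∑ v, F₀ v * Γ.vertexFlux q v := by
    rw [← sum_boundary]
    refine Finset.sum_congr rfl fun e _ => ?_
    rw [(hq e).integral_mul_add_mul (hP' e) (Γ.len_pos e).le, (hends e).1, (hends e).2]
  have heq : ∑ e, ∫ t in Set.Ioo 0 (Γ.len e), (r e t * P' e t + q e t * g' e t) = 0 := by
    refine (Finset.sum_congr rfl fun e _ => integral_congr_ae ?_).trans hweak
    filter_upwards [hqg e] with t ht
    rw [ht]
  rw [heq] at hparts
  simpa [F₀, Pi.single_apply] using hparts

/-- The inverse of `L_u` is `J J†`. -/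
theorem mem_kirchhoffOperator_graph_iff (hκ : κ ≠ 0) (p f : Γ.L2) :
    (p, f) ∈ (Γ.kirchhoffOperator κ u).graph ↔
      p = embeddingL κ hu (embeddingAdjointL κ hu f) := by
  rw [kirchhoffOperator_graph]
  constructor
  · exact fun h => SolvesKirchhoff.eq_embeddingL hu hκ h
  · rintro rfl
    exact solvesKirchhoff_adjoint hu hκ f

end Operator

end MetricGraph

namespace MetricGraph

/-! ### Sines -/

section Sine

variable {ℓ : ℝ}

theorem isPrimitive_sin (ω : ℝ) :
    IsPrimitive ℓ (fun t => Real.sin (ω * t)) fun t => ω * Real.cos (ω * t) := by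
  refine IsPrimitive.of_hasDerivAt (fun t => ?_) (by fun_prop)
  simpa [mul_comm] using ((hasDerivAt_id t).const_mul ω).sin

theorem isPrimitive_cos (ω : ℝ) :
    IsPrimitive ℓ (fun t => ω * Real.cos (ω * t)) fun t => -(ω ^ 2 * Real.sin (ω * t)) := by
  refine IsPrimitive.of_hasDerivAt (fun t => ?_) (by fun_prop)
  have := (((hasDerivAt_id t).const_mul ω).cos).const_mul ω
  convert! this using 1
  simp
  ring

/-- The frequency of the `i`-th Dirichlet eigenfunction of an interval. -/
noncomputable def sineFreq (ℓ : ℝ) (i : ℕ) : ℝ := (i + 1) * Real.pi / ℓ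

theorem sin_sineFreq (hℓ : 0 < ℓ) (i : ℕ) : Real.sin (sineFreq ℓ i * ℓ) = 0 := by
  rw [sineFreq, div_mul_cancel₀ _ hℓ.ne']
  exact_mod_cast Real.sin_nat_mul_pi (i + 1)

theorem sineFreq_pos (hℓ : 0 < ℓ) (i : ℕ) : 0 < sineFreq ℓ i := by
  unfold sineFreq
  positivity

theorem sineFreq_strictMono (hℓ : 0 < ℓ) : StrictMono (sineFreq ℓ) := fun i k h => by
  unfold sineFreq
  have : (i : ℝ) < k := by exact_mod_cast h
  gcongr

/-- Integration by parts; the boundary terms vanish because the sines are zero at both ends. -/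
theorem integral_cos_mul_cos (hℓ : 0 < ℓ) (i k : ℕ) :
    ∫ t in Set.Ioo 0 ℓ, (sineFreq ℓ i * Real.cos (sineFreq ℓ i * t)) *
      (sineFreq ℓ k * Real.cos (sineFreq ℓ k * t)) =
    sineFreq ℓ i ^ 2 *
      ∫ t in Set.Ioo 0 ℓ, Real.sin (sineFreq ℓ i * t) * Real.sin (sineFreq ℓ k * t) := by
  have h := (isPrimitive_cos (ℓ := ℓ) (sineFreq ℓ i)).integral_mul_add_mul
    (isPrimitive_sin (sineFreq ℓ k)) hℓ.le
  rw [sin_sineFreq hℓ, mul_zero, mul_zero, mul_zero, Real.sin_zero, mul_zero, sub_zero] at h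
  have i1 : IntegrableOn (fun t => -(sineFreq ℓ i ^ 2 * Real.sin (sineFreq ℓ i * t)) *
      Real.sin (sineFreq ℓ k * t)) (Set.Ioo 0 ℓ) :=
    integrable_mul (isPrimitive_cos _).memLp ((isPrimitive_sin _).memLp_self hℓ.le)
  have i2 : IntegrableOn (fun t => (sineFreq ℓ i * Real.cos (sineFreq ℓ i * t)) *
      (sineFreq ℓ k * Real.cos (sineFreq ℓ k * t))) (Set.Ioo 0 ℓ) :=
    integrable_mul (isPrimitive_sin _).memLp (isPrimitive_sin _).memLp
  rw [integral_add i1 i2] at h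
  have e : ∫ t in Set.Ioo 0 ℓ, -(sineFreq ℓ i ^ 2 * Real.sin (sineFreq ℓ i * t)) *
      Real.sin (sineFreq ℓ k * t) = -(sineFreq ℓ i ^ 2 *
      ∫ t in Set.Ioo 0 ℓ, Real.sin (sineFreq ℓ i * t) * Real.sin (sineFreq ℓ k * t)) := by
    rw [← integral_const_mul, ← integral_neg]
    congr 1
    ext t
    ring
  rw [e] at h
  linarith

/-- For `i = k`, `integral_cos_mul_cos` and `cos² = 1 - sin²` give `∫ sin² = ℓ - ∫ sin²`. For `i ≠
k`, exchanging the indices there gives the same left side with a different squared frequency, so the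
integral is zero. -/
theorem integral_sin_mul_sin (hℓ : 0 < ℓ) (i k : ℕ) :
    ∫ t in Set.Ioo 0 ℓ, Real.sin (sineFreq ℓ i * t) * Real.sin (sineFreq ℓ k * t) =
      if i = k then ℓ / 2 else 0 := by
  split_ifs with hik
  · subst hik
    have h := integral_cos_mul_cos hℓ i i
    have hω := sineFreq_pos hℓ i
    have i1 : IntegrableOn (fun t => Real.sin (sineFreq ℓ i * t) * Real.sin (sineFreq ℓ i * t))
        (Set.Ioo 0 ℓ) :=
      integrable_mul ((isPrimitive_sin _).memLp_self hℓ.le) ((isPrimitive_sin _).memLp_self hℓ.le)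
    have e : ∫ t in Set.Ioo 0 ℓ, (sineFreq ℓ i * Real.cos (sineFreq ℓ i * t)) *
        (sineFreq ℓ i * Real.cos (sineFreq ℓ i * t)) = sineFreq ℓ i ^ 2 * (ℓ -
        ∫ t in Set.Ioo 0 ℓ, Real.sin (sineFreq ℓ i * t) * Real.sin (sineFreq ℓ i * t)) := by
      have h1 : ∫ _ in Set.Ioo 0 ℓ, (1 : ℝ) = ℓ := by simp [hℓ.le]
      have i2 : IntegrableOn (fun _ : ℝ => (1 : ℝ)) (Set.Ioo 0 ℓ) := integrableOn_const (by simp)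
      have e2 := integral_sub i2 i1
      rw [h1] at e2
      rw [← e2, ← integral_const_mul]
      congr 1
      ext t
      have := Real.sin_sq_add_cos_sq (sineFreq ℓ i * t)
      linear_combination (sineFreq ℓ i ^ 2) * this
    rw [e] at h
    have := mul_left_cancel₀ (pow_ne_zero 2 hω.ne') h
    linarith
  · have h1 := integral_cos_mul_cos hℓ i k
    have h2 := integral_cos_mul_cos hℓ k i
    simp only [mul_comm (Real.sin (sineFreq ℓ k * _))] at h2
    have e : ∫ t in Set.Ioo 0 ℓ, (sineFreq ℓ k * Real.cos (sineFreq ℓ k * t)) *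
        (sineFreq ℓ i * Real.cos (sineFreq ℓ i * t)) =
        ∫ t in Set.Ioo 0 ℓ, (sineFreq ℓ i * Real.cos (sineFreq ℓ i * t)) *
        (sineFreq ℓ k * Real.cos (sineFreq ℓ k * t)) := by
      congr 1
      ext t
      ring
    rw [e, h1] at h2
    have hne : sineFreq ℓ i ^ 2 ≠ sineFreq ℓ k ^ 2 := fun h => hik <|
      (sineFreq_strictMono hℓ).injective <|
        (pow_left_inj₀ (sineFreq_pos hℓ i).le (sineFreq_pos hℓ k).le two_ne_zero).1 h
    have h3 : (sineFreq ℓ i ^ 2 - sineFreq ℓ k ^ 2) *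
        ∫ t in Set.Ioo 0 ℓ, Real.sin (sineFreq ℓ i * t) * Real.sin (sineFreq ℓ k * t) = 0 := by
      linear_combination h2
    exact (mul_eq_zero.1 h3).resolve_left (sub_ne_zero.2 hne)

/-- The square of a linear combination integrates like an orthogonal sum. -/
theorem integral_sum_sq {j : ℕ} {f : ℕ → ℝ → ℝ} {c : ℕ → ℝ}
    (hf : ∀ i, MemLp (f i) 2 (intervalMeasure ℓ))
    (h : ∀ i k, ∫ t in Set.Ioo 0 ℓ, f i t * f k t = if i = k then c i else 0) (a : Fin j → ℝ) :
    ∫ t in Set.Ioo 0 ℓ, (∑ i, a i * f i t) ^ 2 = ∑ i, a i ^ 2 * c i := by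
  have e : ∀ t, (∑ i, a i * f i t) ^ 2 = ∑ i, ∑ k, a i * a k * (f i t * f k t) := fun t => by
    rw [sq, Finset.sum_mul_sum]
    refine Finset.sum_congr rfl fun i _ => Finset.sum_congr rfl fun k _ => ?_
    ring
  have hi : ∀ i k : Fin j, Integrable (fun t => a i * a k * (f i t * f k t)) (intervalMeasure ℓ) :=
    fun i k => (integrable_mul (hf i) (hf k)).const_mul _
  simp only [e]
  rw [integral_finsetSum _ fun i _ => integrable_finsetSum _ fun k _ => hi i k]
  refine Finset.sum_congr rfl fun i _ => ?_
  rw [integral_finsetSum _ fun k _ => hi i k]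
  simp only [integral_const_mul, h, Fin.val_inj, mul_ite, mul_zero, Finset.sum_ite_eq,
    Finset.mem_univ, if_true]
  ring

end Sine

/-! ### Eigenvalue bounds -/

universe w

section Bounds

variable {V : Type*} {E : Type w} [Fintype E] {Γ : MetricGraph V E} {κ : ℝ} {u : E → ℝ → ℝ}

theorem ae_abs_le_linftyNorm (hu : ∀ e, ContinuousOn (u e) (Set.Icc 0 (Γ.len e))) (e : E) :
    ∀ᵐ t ∂(intervalMeasure (Γ.len e)), |u e t| ≤ Γ.linftyNorm u := by
  -- Finiteness excludes the default value `0` of `toReal` at `⊤`.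
  have hfin : (⨆ e, eLpNorm (u e) ⊤ (intervalMeasure (Γ.len e))) ≠ ⊤ := by
    refine ne_top_of_le_ne_top (ENNReal.sum_lt_top (s := Finset.univ)
      (f := fun e => eLpNorm (u e) ⊤ (intervalMeasure (Γ.len e)))
      |>.2 fun e _ => (memLp_of_continuousOn (hu e) ⊤).2).ne ?_
    exact iSup_le fun e => Finset.single_le_sum
      (f := fun e => eLpNorm (u e) ⊤ (intervalMeasure (Γ.len e))) (fun _ _ => zero_le)
      (Finset.mem_univ e)
  filter_upwards [ae_le_eLpNormEssSup (f := u e) (μ := intervalMeasure (Γ.len e))] with t ht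
  rw [← eLpNorm_exponent_top] at ht
  have h1 := ENNReal.toReal_mono hfin
    (ht.trans (le_iSup (fun e => eLpNorm (u e) ⊤ (intervalMeasure (Γ.len e))) e))
  simpa [linftyNorm] using h1

variable (hu : ∀ e, ContinuousOn (u e) (Set.Icc 0 (Γ.len e)))

/-- On functions with mean zero on `n` subintervals of every edge the form is large. -/
theorem exists_forall_norm_sq_embeddingL_le (hκ : κ ≠ 0) {Λ : ℝ} (hΛ : ∀ e, Γ.len e ≤ Λ) {n : ℕ}
    (hn : 0 < n) : ∃ ψ : Γ.formSpace κ hu →L[ℝ] (Fin (Fintype.card E * n) → ℝ), ∀ k, ψ k = 0 →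
      ‖embeddingL κ hu k‖ ^ 2 ≤ (Λ / n) ^ 2 * Real.exp (Γ.linftyNorm u) * ‖k‖ ^ 2 := by
  let φ : Fin (Fintype.card E * n) ≃ E × Fin n :=
    (Fintype.equivFinOfCardEq (by simp)).symm
  let ψ : Γ.formSpace κ hu →L[ℝ] (Fin (Fintype.card E * n) → ℝ) :=
    ContinuousLinearMap.pi fun i =>
      integralL (Γ.len (φ i).1) ((φ i).2 * (Γ.len (φ i).1 / n))
        (((φ i).2 + 1 : ℕ) * (Γ.len (φ i).1 / n)) ∘L
      PiLp.proj 2 (fun e => Lp ℝ 2 (intervalMeasure (Γ.len e))) (φ i).1 ∘L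
      WithLp.fstL 2 ℝ Γ.L2 Γ.L2 ∘L (Γ.formSpace κ hu).subtypeL
  refine ⟨ψ, fun k hk => ?_⟩
  obtain ⟨P, g, hr⟩ := exists_represents hu k.2
  have hn' : (0 : ℝ) < n := by exact_mod_cast hn
  rw [hr.norm_sq_embeddingL hu hκ, hr.norm_sq_eq hu, Finset.mul_sum]
  refine Finset.sum_le_sum fun e _ => ?_
  have hℓ := Γ.len_pos e
  have hmem : ∀ i : ℕ, i ≤ n → (i * (Γ.len e / n) : ℝ) ∈ Set.Icc 0 (Γ.len e) := fun i hi => by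
    refine ⟨by positivity, ?_⟩
    have : (i : ℝ) ≤ n := by exact_mod_cast hi
    calc (i * (Γ.len e / n) : ℝ) ≤ n * (Γ.len e / n) := by gcongr
      _ = Γ.len e := by field_simp
  have hzero : ∀ i < n, ∫ t in (i * (Γ.len e / n))..((i + 1 : ℕ) * (Γ.len e / n)), P e t = 0 := by
    intro i hi
    have h1 : integralL (Γ.len e) (i * (Γ.len e / n)) ((i + 1 : ℕ) * (Γ.len e / n))
        ((k : WithLp 2 (Γ.L2 × Γ.L2)).fst e) = 0 := by
      have h2 := congrFun hk (φ.symm (e, ⟨i, hi⟩))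
      -- The type of the edge component depends on the edge, so the equality of indices is
      -- substituted for a variable `x` instead of rewritten.
      have h3 : ∀ x : E × Fin n, x = (e, ⟨i, hi⟩) →
          integralL (Γ.len x.1) (x.2 * (Γ.len x.1 / n)) ((x.2 + 1 : ℕ) * (Γ.len x.1 / n))
            ((k : WithLp 2 (Γ.L2 × Γ.L2)).fst x.1) = 0 →
          integralL (Γ.len e) (i * (Γ.len e / n)) ((i + 1 : ℕ) * (Γ.len e / n))
            ((k : WithLp 2 (Γ.L2 × Γ.L2)).fst e) = 0 := by
        rintro x rfl h
        exact h
      exact h3 _ (φ.apply_symm_apply _) h2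
    have hle : (i * (Γ.len e / n) : ℝ) ≤ (i + 1 : ℕ) * (Γ.len e / n) := by
      push_cast
      nlinarith [div_pos hℓ hn']
    rw [integralL_eq (hmem i hi.le) (hmem (i + 1) hi) hle,
      integral_congr_of_ae (hr.fst_eq e) (hmem i hi.le) (hmem (i + 1) hi),
      intervalIntegral.integral_const_mul] at h1
    exact (mul_eq_zero.1 h1).resolve_left hκ
  have hP := (hr.isPrimitive e).integral_sq_le_of_partition hℓ hn hzero
  rw [← setIntegral_Ioo_eq hℓ.le, ← setIntegral_Ioo_eq hℓ.le] at hP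
  have hexp : ∫ t in Set.Ioo 0 (Γ.len e), g e t ^ 2 ≤ Real.exp (Γ.linftyNorm u) *
      ∫ t in Set.Ioo 0 (Γ.len e), Real.exp (u e t) * g e t ^ 2 := by
    rw [← integral_const_mul]
    have hm := (hr.isPrimitive e).memLp
    have hi : IntegrableOn (fun t => Real.exp (u e t) * g e t ^ 2) (Set.Ioo 0 (Γ.len e)) := by
      simpa only [sq, mul_assoc] using integrable_mul (memLp_exp_mul (hu e) hm) hm
    refine integral_mono_ae hm.integrable_sq (hi.const_mul _) ?_
    filter_upwards [ae_abs_le_linftyNorm hu e] with t ht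
    rw [← mul_assoc, ← Real.exp_add]
    have : 1 ≤ Real.exp (Γ.linftyNorm u + u e t) :=
      Real.one_le_exp (by linarith [neg_abs_le (u e t)])
    nlinarith [sq_nonneg (g e t)]
  have hnn : 0 ≤ ∫ t in Set.Ioo 0 (Γ.len e), Real.exp (u e t) * g e t ^ 2 :=
    integral_nonneg fun t => by positivity
  have hnn' : 0 ≤ κ ^ 2 * ∫ t in Set.Ioo 0 (Γ.len e), P e t ^ 2 :=
    mul_nonneg (sq_nonneg _) (integral_nonneg fun t => sq_nonneg _)
  have hle : (Γ.len e / n) ^ 2 ≤ (Λ / n) ^ 2 := by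
    have := hΛ e
    gcongr
  calc _ ≤ (Γ.len e / n) ^ 2 * ∫ t in Set.Ioo 0 (Γ.len e), g e t ^ 2 := hP
    _ ≤ (Λ / n) ^ 2 * (Real.exp (Γ.linftyNorm u) *
        ∫ t in Set.Ioo 0 (Γ.len e), Real.exp (u e t) * g e t ^ 2) :=
      mul_le_mul hle hexp (integral_nonneg fun t => sq_nonneg _) (sq_nonneg _)
    _ ≤ _ := by
      rw [← mul_assoc]
      exact mul_le_mul_of_nonneg_left (by linarith) (by positivity)

/-- The derivative term of the form is nonnegative and may be dropped. This holds on the whole form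
space and gives `κ² ≤ λ_j` for every `j`. -/
theorem sq_mul_norm_sq_embeddingL_le (hκ : κ ≠ 0) (k : Γ.formSpace κ hu) :
    ‖embeddingL κ hu k‖ ^ 2 ≤ (κ ^ 2)⁻¹ * ‖k‖ ^ 2 := by
  obtain ⟨P, g, hr⟩ := exists_represents hu k.2
  rw [hr.norm_sq_embeddingL hu hκ, hr.norm_sq_eq hu, Finset.mul_sum]
  refine Finset.sum_le_sum fun e _ => ?_
  have hnn : 0 ≤ ∫ t in Set.Ioo 0 (Γ.len e), Real.exp (u e t) * g e t ^ 2 :=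
    integral_nonneg fun t => by positivity
  rw [mul_add, inv_mul_cancel_left₀ (pow_ne_zero 2 hκ)]
  have := mul_nonneg (inv_nonneg.2 (sq_nonneg κ)) hnn
  linarith

theorem Represents.smul_add {k k' : WithLp 2 (Γ.L2 × Γ.L2)} {P g P' g' : E → ℝ → ℝ} (a : ℝ)
    (h : Γ.Represents κ u k P g) (h' : Γ.Represents κ u k' P' g') :
    Γ.Represents κ u (a • k + k') (fun e t => a * P e t + P' e t)
      (fun e t => a * g e t + g' e t) := by
  obtain ⟨hc, F, hF⟩ := h.isContinuous
  obtain ⟨hc', F', hF'⟩ := h'.isContinuous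
  refine ⟨⟨fun e => ((hc e).const_mul a).add (hc' e), fun v => a * F v + F' v, fun e => ?_⟩,
    fun e => ⟨((h.isPrimitive e).memLp.const_mul a).add (h'.isPrimitive e).memLp, fun t ht => ?_⟩,
    fun e => ?_, fun e => ?_⟩
  · simp [hF, hF']
  · have h0 : (0 : ℝ) ∈ Set.Icc 0 (Γ.len e) := ⟨le_rfl, (Γ.len_pos e).le⟩
    rw [intervalIntegral.integral_add
      (((h.isPrimitive e).intervalIntegrable_of_mem h0 ht).const_mul a)
      ((h'.isPrimitive e).intervalIntegrable_of_mem h0 ht), intervalIntegral.integral_const_mul,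
      (h.isPrimitive e).eq t ht, (h'.isPrimitive e).eq t ht]
    ring
  · have h1 : (a • k + k').fst e = a • k.fst e + k'.fst e := rfl
    rw [h1]
    filter_upwards [h.fst_eq e, h'.fst_eq e, Lp.coeFn_add (a • k.fst e) (k'.fst e),
      Lp.coeFn_smul a (k.fst e)] with t h2 h3 h4 h5
    rw [h4, Pi.add_apply, h5, Pi.smul_apply, h2, h3, smul_eq_mul]
    ring
  · have h1 : (a • k + k').snd e = a • k.snd e + k'.snd e := rfl
    rw [h1]
    filter_upwards [h.snd_eq e, h'.snd_eq e, Lp.coeFn_add (a • k.snd e) (k'.snd e),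
      Lp.coeFn_smul a (k.snd e)] with t h2 h3 h4 h5
    rw [h4, Pi.add_apply, h5, Pi.smul_apply, h2, h3, smul_eq_mul]
    ring

theorem represents_zero :
    Γ.Represents κ u 0 (fun _ _ => 0) (fun _ _ => 0) := by
  refine ⟨⟨fun e => continuousOn_const, 0, fun e => by simp⟩, fun e => isPrimitive_zero _,
    fun e => ?_, fun e => ?_⟩
  · filter_upwards [Lp.coeFn_zero ℝ 2 (intervalMeasure (Γ.len e))] with t ht
    rw [mul_zero]
    exact ht
  · filter_upwards [Lp.coeFn_zero ℝ 2 (intervalMeasure (Γ.len e))] with t ht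
    rw [mul_zero]
    exact ht

theorem Represents.sum_smul {ι : Type*} (s : Finset ι) (a : ι → ℝ)
    {k : ι → WithLp 2 (Γ.L2 × Γ.L2)} {P g : ι → E → ℝ → ℝ}
    (h : ∀ i, Γ.Represents κ u (k i) (P i) (g i)) :
    Γ.Represents κ u (∑ i ∈ s, a i • k i) (fun e t => ∑ i ∈ s, a i * P i e t)
      (fun e t => ∑ i ∈ s, a i * g i e t) := by
  classical
  induction s using Finset.induction_on with
  | empty => simpa using represents_zero
  | insert i s hi ih =>
    simp only [Finset.sum_insert hi]
    exact (h i).smul_add (a i) ih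

/-- Combinations of the first `j` sines on an edge have small form. -/
theorem exists_linearMap_norm_sq_le (hκ : κ ≠ 0) (e : E) (j : ℕ) :
    ∃ σ : (Fin j → ℝ) →ₗ[ℝ] Γ.formSpace κ hu, (∀ a, embeddingL κ hu (σ a) = 0 → a = 0) ∧
      ∀ a, ‖σ a‖ ^ 2 ≤ (κ ^ 2 + Real.exp (Γ.linftyNorm u) * (j * Real.pi / Γ.len e) ^ 2) *
        ‖embeddingL κ hu (σ a)‖ ^ 2 := by
  classical
  set ℓ := Γ.len e with hℓdef
  have hℓ : 0 < ℓ := Γ.len_pos e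
  let s : ℕ → ℝ → ℝ := fun i t => Real.sin (sineFreq ℓ i * t)
  let c : ℕ → ℝ → ℝ := fun i t => sineFreq ℓ i * Real.cos (sineFreq ℓ i * t)
  have hs : ∀ i, IsPrimitive ℓ (s i) (c i) := fun i => isPrimitive_sin _
  have hsm : ∀ i, MemLp (s i) 2 (intervalMeasure ℓ) := fun i => (hs i).memLp_self hℓ.le
  -- The sines vanish at both ends of `e`, so extension by zero is continuous on the graph whatever
  -- the topology.
  choose k hk using fun i : Fin j => exists_mem_represents (κ := κ) hu
    (isContinuous_single ((hs i).continuousOn hℓ.le) (by simp [s]) (sin_sineFreq hℓ i))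
    (isPrimitive_single (hs i))
  let σ : (Fin j → ℝ) →ₗ[ℝ] Γ.formSpace κ hu := Fintype.linearCombination ℝ k
  have hσ : ∀ a : Fin j → ℝ, Γ.Represents κ u (σ a : Γ.formSpace κ hu)
      (fun e' t => ∑ i : Fin j, a i * (Pi.single e (s i) : E → ℝ → ℝ) e' t)
      (fun e' t => ∑ i : Fin j, a i * (Pi.single e (c i) : E → ℝ → ℝ) e' t) := fun a => by
    have := Represents.sum_smul Finset.univ a hk
    simpa [σ, Fintype.linearCombination_apply] using this
  have hsum : ∀ a : Fin j → ℝ, ∫ t in Set.Ioo 0 ℓ, (∑ i : Fin j, a i * s i t) ^ 2 =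
      ∑ i : Fin j, a i ^ 2 * (ℓ / 2) := fun a =>
    integral_sum_sq (c := fun _ => ℓ / 2) hsm (integral_sin_mul_sin hℓ) a
  have hcsum : ∀ a : Fin j → ℝ, ∫ t in Set.Ioo 0 ℓ, (∑ i : Fin j, a i * c i t) ^ 2 =
      ∑ i : Fin j, a i ^ 2 * (sineFreq ℓ i ^ 2 * (ℓ / 2)) := fun a =>
    integral_sum_sq (c := fun i => sineFreq ℓ i ^ 2 * (ℓ / 2)) (fun i => (hs i).memLp)
      (fun i k => by
        rw [integral_cos_mul_cos hℓ, integral_sin_mul_sin hℓ, mul_ite, mul_zero]) a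
  have hJ : ∀ a : Fin j → ℝ, ‖embeddingL κ hu (σ a)‖ ^ 2 = ∑ i, a i ^ 2 * (ℓ / 2) := fun a => by
    rw [(hσ a).norm_sq_embeddingL hu hκ,
      Finset.sum_eq_single e (fun e' _ h => by simp [Pi.single_eq_of_ne h]) (by simp), ← hsum]
    simp only [Pi.single_eq_same]
    rfl
  refine ⟨σ, fun a ha => ?_, fun a => ?_⟩
  · have h := hJ a
    rw [ha, norm_zero, zero_pow two_ne_zero, eq_comm, ← Finset.sum_mul] at h
    have h1 : ∑ i, a i ^ 2 = 0 := (mul_eq_zero.1 h).resolve_right (by positivity)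
    ext i
    have := (Finset.sum_eq_zero_iff_of_nonneg fun i _ => sq_nonneg (a i)).1 h1 i (Finset.mem_univ i)
    simpa using this
  · have hcm : MemLp (fun t => ∑ i : Fin j, a i * c i t) 2 (intervalMeasure ℓ) :=
      memLp_finsetSum _ fun i _ => (hs i).memLp.const_mul (a i)
    have hexp : ∫ t in Set.Ioo 0 ℓ, Real.exp (u e t) * (∑ i : Fin j, a i * c i t) ^ 2 ≤
        Real.exp (Γ.linftyNorm u) * ∫ t in Set.Ioo 0 ℓ, (∑ i : Fin j, a i * c i t) ^ 2 := by
      rw [← integral_const_mul]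
      have hi : IntegrableOn (fun t => Real.exp (u e t) * (∑ i : Fin j, a i * c i t) ^ 2)
          (Set.Ioo 0 ℓ) := by
        simpa only [sq, mul_assoc] using integrable_mul (memLp_exp_mul (hu e) hcm) hcm
      refine integral_mono_ae hi (hcm.integrable_sq.const_mul _) ?_
      filter_upwards [ae_abs_le_linftyNorm hu e] with t ht
      exact mul_le_mul_of_nonneg_right (Real.exp_le_exp.2 ((le_abs_self _).trans ht)) (sq_nonneg _)
    have hfreq : ∑ i : Fin j, a i ^ 2 * (sineFreq ℓ i ^ 2 * (ℓ / 2)) ≤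
        (j * Real.pi / ℓ) ^ 2 * ∑ i, a i ^ 2 * (ℓ / 2) := by
      rw [Finset.mul_sum]
      refine Finset.sum_le_sum fun i _ => ?_
      -- Frequencies are indexed from zero with a shift by one, so `i < j` gives `i + 1 ≤ j`.
      have h1 : sineFreq ℓ i ≤ j * Real.pi / ℓ := by
        have : ((i : ℕ) : ℝ) + 1 ≤ j := by exact_mod_cast i.2
        unfold sineFreq
        gcongr
      have h2 : sineFreq ℓ i ^ 2 ≤ (j * Real.pi / ℓ) ^ 2 :=
        pow_le_pow_left₀ (sineFreq_pos hℓ i).le h1 2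
      have h3 : 0 ≤ a i ^ 2 * (ℓ / 2) := by positivity
      nlinarith [mul_le_mul_of_nonneg_right h2 h3]
    have hnorm : ‖σ a‖ ^ 2 = κ ^ 2 * (∑ i, a i ^ 2 * (ℓ / 2)) +
        ∫ t in Set.Ioo 0 ℓ, Real.exp (u e t) * (∑ i : Fin j, a i * c i t) ^ 2 := by
      rw [(hσ a).norm_sq_eq hu,
        Finset.sum_eq_single e (fun e' _ h => by simp [Pi.single_eq_of_ne h]) (by simp), ← hsum]
      simp only [Pi.single_eq_same]
      rfl
    rw [hnorm, hJ, add_mul, mul_assoc (Real.exp _)]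
    rw [hcsum] at hexp
    have := mul_le_mul_of_nonneg_left hfreq (Real.exp_pos (Γ.linftyNorm u)).le
    linarith

end Bounds

/-! ### Combination of the spectral theory with the estimates of `J` -/

section Eigenvalues

variable {V : Type*} {E : Type w} [Fintype E] {Γ : MetricGraph V E} {κ : ℝ} {u : E → ℝ → ℝ}

/-- The operator `L_u` is inverse to `J J†` for an operator `J` with two-sided norm bounds. -/
theorem exists_factorization [Finite V] (hu : ∀ e, ContinuousOn (u e) (Set.Icc 0 (Γ.len e)))
    (hκ : κ ≠ 0) {Λ : ℝ} (hΛ : ∀ e, Γ.len e ≤ Λ) (e₀ : E) :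
    ∃ (K : Type w) (_ : NormedAddCommGroup K) (_ : InnerProductSpace ℝ K) (_ : CompleteSpace K)
      (J : K →L[ℝ] Γ.L2),
      (∀ p f, (p, f) ∈ (Γ.kirchhoffOperator κ u).graph ↔ p = J (J.adjoint f)) ∧
      (∀ k, ‖J k‖ ^ 2 ≤ (κ ^ 2)⁻¹ * ‖k‖ ^ 2) ∧
      (∀ n : ℕ, 0 < n → ∃ ψ : K →L[ℝ] (Fin (Fintype.card E * n) → ℝ), ∀ k, ψ k = 0 →
        ‖J k‖ ^ 2 ≤ (Λ / n) ^ 2 * Real.exp (Γ.linftyNorm u) * ‖k‖ ^ 2) ∧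
      ∀ j : ℕ, ∃ σ : (Fin j → ℝ) →ₗ[ℝ] K, (∀ a, J (σ a) = 0 → a = 0) ∧
        ∀ a, ‖σ a‖ ^ 2 ≤
          (κ ^ 2 + Real.exp (Γ.linftyNorm u) * (j * Real.pi / Γ.len e₀) ^ 2) * ‖J (σ a)‖ ^ 2 := by
  have : Fintype V := Fintype.ofFinite V
  refine ⟨Γ.formSpace κ hu, inferInstance, inferInstance, inferInstance, embeddingL κ hu,
    ?_, ?_, ?_, ?_⟩
  · exact mem_kirchhoffOperator_graph_iff hu hκ
  · exact sq_mul_norm_sq_embeddingL_le hu hκ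
  · exact fun n hn => exists_forall_norm_sq_embeddingL_le hu hκ hΛ hn
  · exact fun j => exists_linearMap_norm_sq_le hu hκ e₀ j

/-- The eigenvalues of `L_u` exist and satisfy two-sided bounds. -/
theorem eigenvalue_bounds [Finite V] (hu : ∀ e, ContinuousOn (u e) (Set.Icc 0 (Γ.len e)))
    (hκ : κ ≠ 0) {Λ : ℝ} (hΛ : ∀ e, Γ.len e ≤ Λ) (e₀ : E) :
    (∃ lam, IsOrderedEigenvalues (Γ.kirchhoffOperator κ u) lam) ∧
      ∀ lam, IsOrderedEigenvalues (Γ.kirchhoffOperator κ u) lam → ∀ j : ℕ+,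
        κ ^ 2 ≤ lam j ∧
        (∀ n : ℕ, 0 < n → Fintype.card E * n < j →
          1 ≤ (Λ / n) ^ 2 * Real.exp (Γ.linftyNorm u) * lam j) ∧
        lam j ≤ κ ^ 2 + Real.exp (Γ.linftyNorm u) * (j * Real.pi / Γ.len e₀) ^ 2 := by
  obtain ⟨K, _, _, _, J, hA, hκJ, hψJ, hσJ⟩ := exists_factorization hu hκ hΛ e₀
  have hΛ0 : 0 < Λ := (Γ.len_pos e₀).trans_le (hΛ e₀)
  have hsmall : ∀ ε > 0, ∃ n : ℕ, ∃ ψ : K →L[ℝ] (Fin n → ℝ), ∀ k, ψ k = 0 →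
      ‖J k‖ ≤ ε * ‖k‖ := by
    intro ε hε
    -- The bound for `‖J k‖` carries only the square root of `e^{‖u‖}`; replacing it by the larger
    -- `e^{‖u‖}` avoids the root.
    obtain ⟨n, hn⟩ := exists_nat_gt (Λ * Real.exp (Γ.linftyNorm u) / ε)
    have hn0 : (0 : ℝ) < n := lt_trans (by positivity) hn
    obtain ⟨ψ, hψ⟩ := hψJ n (Nat.cast_pos.1 hn0)
    refine ⟨_, ψ, fun k hk => le_of_sq_le_sq ((hψ k hk).trans ?_) (by positivity)⟩
    rw [mul_pow]
    refine mul_le_mul_of_nonneg_right ?_ (sq_nonneg _)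
    have h1 : 1 ≤ Real.exp (Γ.linftyNorm u) := Real.one_le_exp ENNReal.toReal_nonneg
    have h2 : Λ / n * Real.exp (Γ.linftyNorm u) ≤ ε := by
      rw [div_lt_iff₀ hε] at hn
      rw [div_mul_eq_mul_div, div_le_iff₀ hn0]
      linarith
    calc (Λ / n) ^ 2 * Real.exp (Γ.linftyNorm u)
        ≤ (Λ / n) ^ 2 * Real.exp (Γ.linftyNorm u) ^ 2 :=
          mul_le_mul_of_nonneg_left (le_self_pow₀ h1 two_ne_zero) (sq_nonneg _)
      _ = (Λ / n * Real.exp (Γ.linftyNorm u)) ^ 2 := (mul_pow _ _ _).symm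
      _ ≤ ε ^ 2 := pow_le_pow_left₀ (by positivity) h2 2
  have hH : ¬ FiniteDimensional ℝ Γ.L2 := by
    intro hfd
    -- The sines provide an injection from a space of too large dimension.
    obtain ⟨σ, hσ, -⟩ := hσJ (Module.finrank ℝ Γ.L2 + 1)
    have hinj : Function.Injective (J.toLinearMap ∘ₗ σ) := by
      rw [← LinearMap.ker_eq_bot, LinearMap.ker_eq_bot']
      exact hσ
    have := LinearMap.finrank_le_finrank_of_injective hinj
    simp at this
  have hJ := J.isCompactOperator_of_small_on_ker hsmall
  refine ⟨exists_isOrderedEigenvalues_of_inverse hH hsmall hA, fun lam hlam j => ⟨?_, ?_, ?_⟩⟩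
  · have h := hlam.one_le_mul hJ hA j (n := 0) j.pos 0 (c := (κ ^ 2)⁻¹) (by positivity)
      fun k _ => hκJ k
    rwa [le_inv_mul_iff₀ (by positivity), mul_one] at h
  · intro n hn hlt
    obtain ⟨ψ, hψ⟩ := hψJ n hn
    exact hlam.one_le_mul hJ hA j hlt ψ.toLinearMap (by positivity) hψ
  · obtain ⟨σ, hσ, hσ'⟩ := hσJ j
    exact hlam.le_of_norm_sq_le hJ hA j σ hσ hσ'

end Eigenvalues

end MetricGraph

/-! ### Choice of the constants -/

theorem mainTheorem5 {V E : Type*} [Fintype V] [Fintype E] [Nonempty E] (Γ : MetricGraph V E)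
    (κ : ℝ) (hκ : 0 < κ) :
    ∃ C₁ > 0, ∃ C₂ > 0, ∀ u : E → ℝ → ℝ, Γ.MemH (3 / 2) u →
      (∃ lam, IsOrderedEigenvalues (Γ.kirchhoffOperator κ u) lam) ∧
      ∀ lam, IsOrderedEigenvalues (Γ.kirchhoffOperator κ u) lam →
        ∀ j : ℕ+,
          C₁ * Real.exp (-Γ.linftyNorm u) * (j : ℝ) ^ 2 ≤ lam j ∧
          lam j ≤ C₂ * Real.exp (Γ.linftyNorm u) * (j : ℝ) ^ 2 := by
  obtain ⟨e₀⟩ := ‹Nonempty E›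
  let Λ : ℝ := ∑ e, Γ.len e
  have hΛ : ∀ e, Γ.len e ≤ Λ := fun e =>
    Finset.single_le_sum (f := Γ.len) (fun e _ => (Γ.len_pos e).le) (Finset.mem_univ e)
  have hΛ0 : 0 < Λ := (Γ.len_pos e₀).trans_le (hΛ e₀)
  set N := Fintype.card E with hN
  have hN0 : 0 < N := Fintype.card_pos_iff.2 ⟨e₀⟩
  have hN0' : (0 : ℝ) < N := by exact_mod_cast hN0
  have hℓ := Γ.len_pos e₀
  -- In the lower constant the first entry serves `j ≤ N`, through `λ_j ≥ κ²`, and the second serves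
  -- `j > N`, through the Poincaré bound.
  refine ⟨min (κ ^ 2 / N ^ 2) (1 / (2 * N * Λ) ^ 2), by positivity,
    κ ^ 2 + (Real.pi / Γ.len e₀) ^ 2, by positivity, fun u hu => ?_⟩
  obtain ⟨hex, hbd⟩ := MetricGraph.eigenvalue_bounds (κ := κ) hu.1.2.1 hκ.ne' hΛ e₀
  refine ⟨hex, fun lam hlam j => ?_⟩
  obtain ⟨h1, h2, h3⟩ := hbd lam hlam j
  set M := Γ.linftyNorm u
  have hM : 0 ≤ M := ENNReal.toReal_nonneg
  have hj : (1 : ℝ) ≤ j := by exact_mod_cast j.pos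
  constructor
  · rcases le_or_gt (j : ℕ) N with hjN | hjN
    · have hjN' : (j : ℝ) ≤ N := by exact_mod_cast hjN
      have e1 : Real.exp (-M) ≤ 1 := Real.exp_le_one_iff.2 (by linarith)
      calc _ ≤ κ ^ 2 / N ^ 2 * 1 * (N : ℝ) ^ 2 := by
            gcongr
            exact min_le_left _ _
        _ = κ ^ 2 := by field_simp
        _ ≤ _ := h1
    -- The largest `n` with `N n < j`. It is positive because `j > N`, and maximality gives `j ≤ N
    -- (n + 1) ≤ 2 N n`.
    · let n : ℕ := (j - 1) / N
      have hn : 0 < n := Nat.div_pos (by omega) hN0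
      have hn' : (0 : ℝ) < n := by exact_mod_cast hn
      have hlt : N * n < j := by
        have := Nat.mul_div_le ((j : ℕ) - 1) N
        have := j.pos
        change N * (((j : ℕ) - 1) / N) < j
        omega
      have hjn : (j : ℝ) ≤ 2 * N * n := by
        have h4 : (j : ℕ) - 1 < N * (n + 1) := Nat.lt_mul_div_succ _ hN0
        have h5 : (j : ℕ) ≤ N * (n + 1) := by omega
        have h6 : N * (n + 1) ≤ 2 * N * n := by nlinarith
        exact_mod_cast h5.trans h6
      have h4 := h2 n hn hlt
      have h5 : (j : ℝ) ^ 2 ≤ (2 * N * n) ^ 2 := pow_le_pow_left₀ (by positivity) hjn 2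
      calc _ ≤ 1 / (2 * N * Λ) ^ 2 * Real.exp (-M) * (2 * N * n) ^ 2 := by
            gcongr
            exact min_le_right _ _
        _ = (n / Λ) ^ 2 * Real.exp (-M) * 1 := by field_simp
        _ ≤ (n / Λ) ^ 2 * Real.exp (-M) * ((Λ / n) ^ 2 * Real.exp M * lam j) := by gcongr
        _ = (Real.exp (-M) * Real.exp M) * lam j := by field_simp
        _ = lam j := by rw [← Real.exp_add, neg_add_cancel, Real.exp_zero, one_mul]
  · have e1 : 1 ≤ Real.exp M := Real.one_le_exp hM
    have e2 : 1 ≤ (j : ℝ) ^ 2 := one_le_pow₀ hj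
    -- This absorbs the additive `κ²` into the quadratic growth.
    have e3 : 1 ≤ Real.exp M * (j : ℝ) ^ 2 := one_le_mul_of_one_le_of_one_le e1 e2
    calc lam j ≤ κ ^ 2 * 1 + Real.exp M * (j * Real.pi / Γ.len e₀) ^ 2 := by rwa [mul_one]
      _ ≤ κ ^ 2 * (Real.exp M * (j : ℝ) ^ 2) + Real.exp M * (j * Real.pi / Γ.len e₀) ^ 2 := by
        gcongr
      _ = _ := by ring
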